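/- Let $n\ge 2$ and $k\ge 0$ be integers. Write points of $\mathbb C^{2n}=\mathbb R^{4n}$ as $(z,w)$ with $z,w\in\mathbb C^n$, and let $\mathcal H^k$ be the complex vector space of harmonic polynomial functions on $\mathbb R^{4n}$, with complex coefficients, that are homogeneous of degree $k$. Let $Sp(1)$ be the group of matrices $q=\begin{pmatrix} a&-\bar b\\ b&\bar a\end{pmatrix}$ with $a,b\in\mathbb C$, $|a|^2+|b|^2=1$. It acts on functions $f:\mathbb C^{2n}\to\mathbb C$, and on $\mathcal H^k$, by $$R(q)f(z,w)=f(az-b\bar w,\;aw+b\bar z).$$ For integers $\alpha,\beta\ge 0$ and $0\le\gamma\le\min(\alpha,\beta)$ put $$P_\gamma^{\alpha,\beta}(z,w)=w_1^{\alpha-\gamma}\,\bar z_1^{\,\beta-\gamma}\,(w_2\bar z_1-w_1\bar z_2)^\gamma .$$ Let $Sp(n)=U(2n)\cap Sp(2n,\mathbb C)$, acting on functions on $\mathbb C^{2n}$ by $L(u)f(x)=f(u^{-1}x)$, and let $V_\gamma^{\alpha,\beta}$ be the $Sp(n)$-invariant subspace generated by $P_\gamma^{\alpha,\beta}$. For $0\le\gamma\le\lfloor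 k/2\rfloor$ put $$W_\gamma^k=\mathrm{span}_{\mathbb C}\{P_\gamma^{\alpha,k-\alpha}:\gamma\le\alpha\le k-\gamma\},\qquad d_\gamma^k=\dim_{\mathbb C}V_\gamma^{k-\gamma,\gamma}.$$ Then: 1. For each integer $0\le\gamma\le\lfloor k/2\rfloor$, $W_\gamma^k$ is an $Sp(1)$-invariant subspace of $\mathcal H^k$ on which $R$ is irreducible of highest weight $k-2\gamma$; that is, it contains a nonzero vector $v$ with $dR(E)v=0$ and $dR(H)v=(k-2\gamma)v$, where $H=\begin{pmatrix}1&0\\0&-1\end{pmatrix}$, $E=\begin{pmatrix}0&1\\0&0\end{pmatrix}$ and $dR$ is the differential of $R$ extended complex linearly to $\mathfrak{sl}(2,\mathbb C)$. For distinct $\gamma$ these representations are pairwise inequivalent. 2. The isotypic decomposition of $R$ on $\mathcal H^k$ is $$R|_{\mathcal H^k}\;\simeq\;\bigoplus_{0\le\gamma\le\lfloor k/2\rfloor} d_\gamma^k\;R|_{W_\gamma^k},$$ so that the multiplicity of $R|_{W_\gamma^k}$ is $d_\gamma^k=\dim V_\gamma^{k-\gamma,\gamma}$. 3. For each integer $0\le\gamma\le\lfloor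 k/2\rfloor$, $$d_\gamma^k=\frac{(k-\gamma+2n-2)!\,(\gamma+2n-3)!\,(k-2\gamma+1)\,(k+2n-1)}{(k-\gamma+1)!\,\gamma!\,(2n-1)!\,(2n-3)!}.$$ -/

import Mathlib

open scoped ComplexConjugate

namespace QuatHarm

/-- The space `ℂ²ⁿ = ℂⁿ × ℂⁿ`, identified with `ℍⁿ` through `h = z + j w`.
A point `x` has coordinates `z i = x (Sum.inl i)` and `w i = x (Sum.inr i)`. -/
abbrev Pt (n : ℕ) : Type := Fin n ⊕ Fin n → ℂ

/-- Complex polynomials in the coordinates of `ℂ²ⁿ` (the variables `Sum.inl c`) and in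
their complex conjugates (the variables `Sum.inr c`). -/
abbrev Poly (n : ℕ) : Type := MvPolynomial ((Fin n ⊕ Fin n) ⊕ (Fin n ⊕ Fin n)) ℂ

/-- The function on `ℂ²ⁿ = ℝ⁴ⁿ` defined by a polynomial in the coordinates and
their conjugates. -/
noncomputable def polyFun (n : ℕ) : Poly n →ₗ[ℂ] (Pt n → ℂ) where
  toFun p := fun x => MvPolynomial.eval (Sum.elim x (fun c => conj (x c))) p
  map_add' p q := by ext x; simp
  map_smul' c p := by ext x; simp

/-- The Laplace operator of `ℝ⁴ⁿ` in complex coordinates: `4 ∑ ∂²/∂c∂c̄`, where `c` runs through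
the `2n` complex coordinates. -/
noncomputable def laplacian (n : ℕ) : Poly n →ₗ[ℂ] Poly n :=
  (4 : ℂ) • ∑ c : Fin n ⊕ Fin n,
    (MvPolynomial.pderiv (Sum.inl c)).toLinearMap ∘ₗ (MvPolynomial.pderiv (Sum.inr c)).toLinearMap

/-- The space `ℋᵏ` of harmonic polynomial functions on `ℝ⁴ⁿ = ℂ²ⁿ` that are homogeneous of
degree `k`. -/
noncomputable def harmSubmodule (n k : ℕ) : Submodule ℂ (Pt n → ℂ) :=
  (MvPolynomial.homogeneousSubmodule _ ℂ k ⊓ LinearMap.ker (laplacian n)).map (polyFun n)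

/-! ### The right action of `Sp(1)` -/

/-- The group `Sp(1)` of unit quaternions `q = a + j b`, realised by the matrices
`!![a, -b̄; b, ā]` with `|a|² + |b|² = 1`, that is, as `SU(2)`. -/
abbrev Sp1 : Type := Matrix.specialUnitaryGroup (Fin 2) ℂ

/-- Right multiplication of `h = z + j w` by the quaternion `a + j b`, where `a` and `b` are the
entries of the first column of `M`: `(z, w) ↦ (a z - b w̄, a w + b z̄)`. -/
noncomputable def rmul {n : ℕ} (M : Matrix (Fin 2) (Fin 2) ℂ) (x : Pt n) : Pt n :=
  Sum.elim (fun i => M 0 0 * x (Sum.inl i) - M 1 0 * conj (x (Sum.inr i)))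
    (fun i => M 0 0 * x (Sum.inr i) + M 1 0 * conj (x (Sum.inl i)))

theorem sp1_entry (q : Sp1) : q.1 0 1 = - conj (q.1 1 0) ∧ q.1 1 1 = conj (q.1 0 0) := by
  have hu : q.1 * star q.1 = 1 := (Matrix.mem_unitaryGroup_iff).1 q.2.1
  have hd : q.1.det = 1 := q.2.2
  have hadj : q.1.adjugate = star q.1 := by
    have h1 : q.1.adjugate * (q.1 * star q.1) = q.1.adjugate := by rw [hu, mul_one]
    rw [← mul_assoc, Matrix.adjugate_mul, hd, one_smul, one_mul] at h1
    exact h1.symm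
  rw [Matrix.adjugate_fin_two] at hadj
  have h01 := congrFun (congrFun hadj 0) 1
  have h00 := congrFun (congrFun hadj 0) 0
  simp [Matrix.star_apply] at h01 h00
  exact ⟨by rw [← h01, neg_neg], h00⟩

theorem sp1_norm (q : Sp1) : q.1 0 0 * conj (q.1 0 0) + q.1 1 0 * conj (q.1 1 0) = 1 := by
  have hd : q.1.det = 1 := q.2.2
  rw [Matrix.det_fin_two, (sp1_entry q).1, (sp1_entry q).2] at hd
  linear_combination hd

/-- The right action `R` of `Sp(1)` on functions `ℂ²ⁿ → ℂ`:
`R(q) f (z, w) = f (a z - b w̄, a w + b z̄)`. -/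
noncomputable def rightRep (n : ℕ) : Representation ℂ Sp1 (Pt n → ℂ) where
  toFun q :=
    { toFun := fun f x => f (rmul q.1 x)
      map_add' := fun _ _ => rfl
      map_smul' := fun _ _ => rfl }
  map_one' := by
    ext f x
    have h : rmul (n := n) (1 : Matrix (Fin 2) (Fin 2) ℂ) x = x := by
      funext c
      rcases c with i | i <;> simp [rmul]
    change f (rmul (1 : Matrix (Fin 2) (Fin 2) ℂ) x) = f x
    rw [h]
  map_mul' p q := by
    ext f x
    have h : rmul (n := n) (p.1 * q.1) x = rmul q.1 (rmul p.1 x) := by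
      obtain ⟨h1, h2⟩ := sp1_entry p
      funext c
      rcases c with i | i <;>
        simp [rmul, Matrix.mul_apply, Fin.sum_univ_two, h1, h2] <;> ring
    change f (rmul (p.1 * q.1) x) = f (rmul q.1 (rmul p.1 x))
    rw [h]

theorem rightRep_apply (n : ℕ) (q : Sp1) (f : Pt n → ℂ) (x : Pt n) :
    rightRep n q f x = f (rmul q.1 x) := rfl

/-! ### Invariance of `ℋᵏ` -/

/-- The linear substitution of variables induced by right multiplication by `a + j b`. -/
noncomputable def subst (n : ℕ) (a b : ℂ) : Poly n →ₐ[ℂ] Poly n :=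
  MvPolynomial.aeval (Sum.elim
    (Sum.elim
      (fun i => MvPolynomial.C a * MvPolynomial.X (Sum.inl (Sum.inl i))
        - MvPolynomial.C b * MvPolynomial.X (Sum.inr (Sum.inr i)))
      (fun i => MvPolynomial.C a * MvPolynomial.X (Sum.inl (Sum.inr i))
        + MvPolynomial.C b * MvPolynomial.X (Sum.inr (Sum.inl i))))
    (Sum.elim
      (fun i => MvPolynomial.C (conj a) * MvPolynomial.X (Sum.inr (Sum.inl i))
        - MvPolynomial.C (conj b) * MvPolynomial.X (Sum.inl (Sum.inr i)))
      (fun i => MvPolynomial.C (conj a) * MvPolynomial.X (Sum.inr (Sum.inr i))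
        + MvPolynomial.C (conj b) * MvPolynomial.X (Sum.inl (Sum.inl i)))))

theorem polyFun_subst (n : ℕ) (M : Matrix (Fin 2) (Fin 2) ℂ) (p : Poly n) (x : Pt n) :
    polyFun n (subst n (M 0 0) (M 1 0) p) x = polyFun n p (rmul M x) := by
  change MvPolynomial.eval _ _ = MvPolynomial.eval _ _
  induction p using MvPolynomial.induction_on with
  | C c => simp [subst]
  | add p q hp hq => rw [map_add, map_add, map_add, hp, hq]
  | mul_X p v hp =>
    rw [map_mul, map_mul, map_mul, hp]
    congr 1
    rcases v with (i | i) | (i | i) <;> simp [subst, rmul]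

theorem subst_isHomogeneous (n : ℕ) (a b : ℂ) {k : ℕ} {p : Poly n} (hp : p.IsHomogeneous k) :
    (subst n a b p).IsHomogeneous k := by
  have h := hp.aeval (n := 1) (Sum.elim
    (Sum.elim
      (fun i => MvPolynomial.C a * MvPolynomial.X (Sum.inl (Sum.inl i))
        - MvPolynomial.C b * MvPolynomial.X (Sum.inr (Sum.inr i)))
      (fun i => MvPolynomial.C a * MvPolynomial.X (Sum.inl (Sum.inr i))
        + MvPolynomial.C b * MvPolynomial.X (Sum.inr (Sum.inl i))))
    (Sum.elim
      (fun i => MvPolynomial.C (conj a) * MvPolynomial.X (Sum.inr (Sum.inl i))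
        - MvPolynomial.C (conj b) * MvPolynomial.X (Sum.inl (Sum.inr i)))
      (fun i => MvPolynomial.C (conj a) * MvPolynomial.X (Sum.inr (Sum.inr i))
        + MvPolynomial.C (conj b) * MvPolynomial.X (Sum.inl (Sum.inl i)))) :
        (Fin n ⊕ Fin n) ⊕ (Fin n ⊕ Fin n) → Poly n) (by
      rintro ((i | i) | (i | i))
      · exact (MvPolynomial.isHomogeneous_C_mul_X _ _).sub (MvPolynomial.isHomogeneous_C_mul_X _ _)
      · exact (MvPolynomial.isHomogeneous_C_mul_X _ _).add (MvPolynomial.isHomogeneous_C_mul_X _ _)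
      · exact (MvPolynomial.isHomogeneous_C_mul_X _ _).sub (MvPolynomial.isHomogeneous_C_mul_X _ _)
      · exact (MvPolynomial.isHomogeneous_C_mul_X _ _).add (MvPolynomial.isHomogeneous_C_mul_X _ _))
  rw [one_mul] at h
  exact h

theorem pderiv_subst (n : ℕ) (a b : ℂ) (p : Poly n) (i : Fin n) :
    (MvPolynomial.pderiv (Sum.inl (Sum.inl i)) (subst n a b p) =
      MvPolynomial.C a * subst n a b (MvPolynomial.pderiv (Sum.inl (Sum.inl i)) p)
      + MvPolynomial.C (conj b) * subst n a b (MvPolynomial.pderiv (Sum.inr (Sum.inr i)) p)) ∧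
    (MvPolynomial.pderiv (Sum.inl (Sum.inr i)) (subst n a b p) =
      MvPolynomial.C a * subst n a b (MvPolynomial.pderiv (Sum.inl (Sum.inr i)) p)
      - MvPolynomial.C (conj b) * subst n a b (MvPolynomial.pderiv (Sum.inr (Sum.inl i)) p)) ∧
    (MvPolynomial.pderiv (Sum.inr (Sum.inl i)) (subst n a b p) =
      MvPolynomial.C (conj a) * subst n a b (MvPolynomial.pderiv (Sum.inr (Sum.inl i)) p)
      + MvPolynomial.C b * subst n a b (MvPolynomial.pderiv (Sum.inl (Sum.inr i)) p)) ∧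
    (MvPolynomial.pderiv (Sum.inr (Sum.inr i)) (subst n a b p) =
      MvPolynomial.C (conj a) * subst n a b (MvPolynomial.pderiv (Sum.inr (Sum.inr i)) p)
      - MvPolynomial.C b * subst n a b (MvPolynomial.pderiv (Sum.inl (Sum.inl i)) p)) := by
  induction p using MvPolynomial.induction_on with
  | C c => simp [subst]
  | add p q hp hq =>
    obtain ⟨h1, h2, h3, h4⟩ := hp
    obtain ⟨g1, g2, g3, g4⟩ := hq
    simp only [map_add, h1, h2, h3, h4, g1, g2, g3, g4]
    refine ⟨?_, ?_, ?_, ?_⟩ <;> ring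
  | mul_X p v hp =>
    obtain ⟨h1, h2, h3, h4⟩ := hp
    simp only [map_mul, MvPolynomial.pderiv_mul, map_add, h1, h2, h3, h4]
    rcases v with (l | l) | (l | l) <;> by_cases hl : l = i <;>
      refine ⟨?_, ?_, ?_, ?_⟩ <;>
      simp [subst, MvPolynomial.pderiv_X, hl] <;> ring

theorem pderiv_comm (n : ℕ) (u v : (Fin n ⊕ Fin n) ⊕ (Fin n ⊕ Fin n)) (p : Poly n) :
    MvPolynomial.pderiv u (MvPolynomial.pderiv v p) =
      MvPolynomial.pderiv v (MvPolynomial.pderiv u p) := by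
  have h : ⁅MvPolynomial.pderiv (R := ℂ) u, MvPolynomial.pderiv (R := ℂ) v⁆ = 0 := by
    refine MvPolynomial.derivation_ext fun w => ?_
    rw [Derivation.commutator_apply, MvPolynomial.pderiv_X, MvPolynomial.pderiv_X]
    simp only [Pi.single_apply]
    split_ifs <;> simp
  have h2 := congrArg (fun D => D p) h
  simp only [Derivation.commutator_apply, Derivation.zero_apply] at h2
  exact sub_eq_zero.1 h2

theorem laplacian_apply (n : ℕ) (p : Poly n) :
    laplacian n p = (4 : ℂ) • ∑ i : Fin n,
      (MvPolynomial.pderiv (Sum.inl (Sum.inl i)) (MvPolynomial.pderiv (Sum.inr (Sum.inl i)) p)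
      + MvPolynomial.pderiv (Sum.inl (Sum.inr i))
          (MvPolynomial.pderiv (Sum.inr (Sum.inr i)) p)) := by
  rw [Finset.sum_add_distrib]
  simp [laplacian]

theorem laplacian_subst (n : ℕ) (a b : ℂ) (hab : a * conj a + b * conj b = 1) (p : Poly n) :
    laplacian n (subst n a b p) = subst n a b (laplacian n p) := by
  have hC : (MvPolynomial.C a * MvPolynomial.C (conj a)
      + MvPolynomial.C b * MvPolynomial.C (conj b) : Poly n) = 1 := by
    rw [← map_mul, ← map_mul, ← map_add, hab, map_one]
  rw [laplacian_apply, laplacian_apply, map_smul, map_sum]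
  congr 1
  refine Finset.sum_congr rfl fun i _ => ?_
  rw [(pderiv_subst n a b p i).2.2.1, (pderiv_subst n a b p i).2.2.2]
  simp only [map_add, map_sub, MvPolynomial.pderiv_C_mul,
    (pderiv_subst n a b _ i).1, (pderiv_subst n a b _ i).2.1]
  rw [pderiv_comm n (Sum.inl (Sum.inr i)) (Sum.inl (Sum.inl i)) p,
    pderiv_comm n (Sum.inr (Sum.inr i)) (Sum.inr (Sum.inl i)) p,
    pderiv_comm n (Sum.inr (Sum.inr i)) (Sum.inl (Sum.inr i)) p,
    pderiv_comm n (Sum.inr (Sum.inl i)) (Sum.inl (Sum.inl i)) p]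
  linear_combination
    (subst n a b (MvPolynomial.pderiv (Sum.inl (Sum.inl i))
      (MvPolynomial.pderiv (Sum.inr (Sum.inl i)) p))
    + subst n a b (MvPolynomial.pderiv (Sum.inl (Sum.inr i))
      (MvPolynomial.pderiv (Sum.inr (Sum.inr i)) p))) * hC

/-- The space `ℋᵏ` as a subrepresentation of the right action of `Sp(1)`. -/
noncomputable def harm (n k : ℕ) : Subrepresentation (rightRep n) where
  toSubmodule := harmSubmodule n k
  apply_mem_toSubmodule := by
    rintro q _ ⟨p, ⟨hp, hl⟩, rfl⟩
    refine ⟨subst n (q.1 0 0) (q.1 1 0) p, ⟨subst_isHomogeneous n _ _ hp, ?_⟩, ?_⟩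
    · have h0 : laplacian n p = 0 := hl
      change laplacian n _ = 0
      rw [laplacian_subst n _ _ (sp1_norm q), h0, map_zero]
    · funext x
      exact polyFun_subst n q.1 p x

/-! ### The polynomials `P` and the spaces `V` and `W` -/

/-- The function
`P(z, w) = w₁ ^ (α - γ) * z̄₁ ^ (β - γ) * (w₂ z̄₁ - w₁ z̄₂) ^ γ`, used for `γ ≤ min α β`. -/
noncomputable def hwPoly (n : ℕ) (hn : 2 ≤ n) (γ α β : ℕ) : Pt n → ℂ := fun x =>
  x (Sum.inr ⟨0, by omega⟩) ^ (α - γ) * conj (x (Sum.inl ⟨0, by omega⟩)) ^ (β - γ) *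
    (x (Sum.inr ⟨1, by omega⟩) * conj (x (Sum.inl ⟨0, by omega⟩))
      - x (Sum.inr ⟨0, by omega⟩) * conj (x (Sum.inl ⟨1, by omega⟩))) ^ γ

/-- The compact group `Sp(n) = U(2n) ∩ Sp(2n, ℂ)` of linear isometries of `ℍⁿ`, that is, the
unitary matrices of the form `[A, -B̄; B, Ā]`. -/
def spGroup (n : ℕ) : Submonoid (Matrix (Fin n ⊕ Fin n) (Fin n ⊕ Fin n) ℂ) :=
  Matrix.unitaryGroup (Fin n ⊕ Fin n) ℂ ⊓ Matrix.symplecticGroup (Fin n) ℂ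

/-- The left action `L(u) f (x) = f (u⁻¹ x)`. -/
noncomputable def leftAct {n : ℕ} (u : Matrix (Fin n ⊕ Fin n) (Fin n ⊕ Fin n) ℂ)
    (f : Pt n → ℂ) : Pt n → ℂ := fun x => f (u⁻¹.mulVec x)

/-- The `Sp(n)`-invariant subspace (for the left action) generated by the highest weight vector
`hwPoly n hn γ α β`. -/
noncomputable def spV (n : ℕ) (hn : 2 ≤ n) (γ α β : ℕ) : Submodule ℂ (Pt n → ℂ) :=
  Submodule.span ℂ {f | ∃ u ∈ spGroup n, f = leftAct u (hwPoly n hn γ α β)}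

/-- The dimension of the `Sp(n)`-type of highest weight `(k - γ, γ, 0, …, 0)`. -/
noncomputable def spDim (n : ℕ) (hn : 2 ≤ n) (k γ : ℕ) : ℕ :=
  Module.finrank ℂ (spV n hn γ (k - γ) γ)

/-- The span of the functions `hwPoly n hn γ α (k - α)` for `γ ≤ α ≤ k - γ`. -/
noncomputable def spWSubmodule (n : ℕ) (hn : 2 ≤ n) (k γ : ℕ) : Submodule ℂ (Pt n → ℂ) :=
  Submodule.span ℂ {f | ∃ α, γ ≤ α ∧ α ≤ k - γ ∧ f = hwPoly n hn γ α (k - α)}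

theorem binary_form_mem {X : Type*} (S : Submodule ℂ (X → ℂ)) (u v D : X → ℂ) (p r : ℕ)
    (hS : ∀ i j, i + j = p + r → u ^ i * v ^ j * D ∈ S) (a b c d : ℂ) :
    (a • u + b • v) ^ p * (c • u + d • v) ^ r * D ∈ S := by
  rw [add_pow, add_pow, Finset.sum_mul_sum, Finset.sum_mul]
  refine Submodule.sum_mem _ fun i hi => ?_
  rw [Finset.sum_mul]
  refine Submodule.sum_mem _ fun j hj => ?_
  have hi' : i ≤ p := Nat.lt_succ_iff.1 (Finset.mem_range.1 hi)
  have hj' : j ≤ r := Nat.lt_succ_iff.1 (Finset.mem_range.1 hj)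
  have h := S.smul_mem (a ^ i * b ^ (p - i) * p.choose i * (c ^ j * d ^ (r - j) * r.choose j))
    (hS (i + j) ((p - i) + (r - j)) (by omega))
  convert h using 1
  funext x
  simp only [Pi.mul_apply, Pi.pow_apply, Pi.smul_apply, smul_eq_mul, Pi.natCast_apply, mul_pow]
  ring

/-- The space `W` as a subrepresentation of the right action of `Sp(1)`. -/
noncomputable def spW (n : ℕ) (hn : 2 ≤ n) (k γ : ℕ) : Subrepresentation (rightRep n) where
  toSubmodule := spWSubmodule n hn k γ
  apply_mem_toSubmodule := by
    intro q f hf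
    have hle : spWSubmodule n hn k γ ≤ (spWSubmodule n hn k γ).comap (rightRep n q) := by
      refine Submodule.span_le.2 ?_
      rintro _ ⟨α, h1, h2, rfl⟩
      have hm := binary_form_mem (spWSubmodule n hn k γ)
        (fun x : Pt n => x (Sum.inr ⟨0, by omega⟩))
        (fun x : Pt n => conj (x (Sum.inl ⟨0, by omega⟩)))
        (fun x : Pt n => (x (Sum.inr ⟨1, by omega⟩) * conj (x (Sum.inl ⟨0, by omega⟩))
          - x (Sum.inr ⟨0, by omega⟩) * conj (x (Sum.inl ⟨1, by omega⟩))) ^ γ)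
        (α - γ) (k - α - γ) (fun i j hij => Submodule.subset_span
          ⟨i + γ, by omega, by omega, by
            funext x
            have e1 : i + γ - γ = i := by omega
            have e2 : k - (i + γ) - γ = j := by omega
            simp [hwPoly, e1, e2]⟩)
        (q.1 0 0) (q.1 1 0) (- conj (q.1 1 0)) (conj (q.1 0 0))
      change rightRep n q (hwPoly n hn γ α (k - α)) ∈ spWSubmodule n hn k γ
      convert hm using 1
      funext x
      have hq := sp1_norm q
      simp only [rightRep_apply, hwPoly, rmul, Sum.elim_inl, Sum.elim_inr, Pi.mul_apply,
        Pi.pow_apply, Pi.add_apply, Pi.smul_apply, smul_eq_mul, map_sub, map_mul,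
        Complex.conj_conj]
      congr 1
      · congr 1
        ring
      · congr 1
        linear_combination (x (Sum.inr ⟨1, by omega⟩) * conj (x (Sum.inl ⟨0, by omega⟩))
          - x (Sum.inr ⟨0, by omega⟩) * conj (x (Sum.inl ⟨1, by omega⟩))) * hq
    exact hle hf

/-! ### Highest weights for the right action -/

/-- For `X` in the Lie algebra of `Sp(1)`:
`dR(X) f (x) = d/dt|_{t = 0} (R(exp(t X)) f) (x)`. -/
noncomputable def dRightReal {n : ℕ} (X : Matrix (Fin 2) (Fin 2) ℂ) (f : Pt n → ℂ) : Pt n → ℂ :=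
  fun x => deriv (fun t : ℝ => f (rmul (NormedSpace.exp (t • X)) x)) 0

/-- The complex linear extension of `dR` to `𝔰𝔩(2, ℂ)`: `dR(Z) = dR(X) + i dR(Y)`, where
`Z = X + i Y` is the unique decomposition with `X` and `Y` in the Lie algebra of `Sp(1)`, the
traceless skew-Hermitian matrices. -/
noncomputable def dRight {n : ℕ} (Z : Matrix (Fin 2) (Fin 2) ℂ) (f : Pt n → ℂ) : Pt n → ℂ :=
  dRightReal ((1 / 2 : ℂ) • (Z - Z.conjTranspose)) f
    + Complex.I • dRightReal ((-Complex.I / 2) • (Z + Z.conjTranspose)) f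

/-- A subrepresentation of the right action of `Sp(1)` has a highest weight vector of weight `m`:
a nonzero vector `v` with `dR(E) v = 0` and `dR(H) v = m v`. -/
def HasHighestWeight {n : ℕ} (S : Subrepresentation (rightRep n)) (m : ℕ) : Prop :=
  ∃ v ∈ S, v ≠ 0 ∧ dRight !![0, 1; 0, 0] v = 0 ∧ dRight !![1, 0; 0, -1] v = (m : ℂ) • v

end QuatHarm

/-!
Functions on `ℂ²ⁿ` are written as polynomials in the coordinates `c` and their conjugates `c̄`,
which is faithful (`polyFun_injective`). Bihomogeneous polynomials of bidegree `(p, q)` are the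
weight spaces, of weight `p - q`, of the torus of `Sp(1)`; the differential of the right action is
given by the derivations `E = raiseOp` (`z̄ ↦ w`, `w̄ ↦ -z`) and `F = lowerOp`. For the Fischer
inner product, multiplication by a variable is adjoint to the partial derivative, so that `E` is
adjoint to `F`, and the Laplacian, up to a factor, to the multiplication by `quad = ∑ c c̄`.

*Dimensions.* By adjointness, the Laplacian is surjective on bihomogeneous polynomials, and `E` is
surjective onto positive weights of the harmonic polynomials. Counting monomials gives the
dimension of the space `primitives n p q` of harmonic polynomials of bidegree `(p, q)` killed by `E`
(`finrank_primitives`).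

*The space `V`.* It is equal to `primitives n (k - γ) γ` (`spV_eq`). The translates of the highest
weight vector by `Sp(n)` are the products `weightPoly a b (k - 2γ) 0 γ` with `a`, `b` orthonormal
over the quaternions, because such a pair extends to a quaternionic basis
(`exists_spGroup_of_isFrame`). If a primitive `f` is orthogonal to all of them, a form of Capelli's
identity (`fischer_weightPoly`) shows that `f` vanishes at all points `(a, rot b)`. By homogeneity
and by invariance under the shears generated by `E`, it vanishes on the quadric `quad = 0`, so that
`quad` divides `f`; as `f` is harmonic, it is orthogonal to multiples of `quad`, hence zero
(`eq_zero_of_fischer_weightPoly`).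

*The spaces `W`.* They have one weight vector `weightFun` in each bidegree `(k - q, q)` with
`γ ≤ q ≤ k - γ`. An invariant subspace contains the weight components of its elements, and a
rotation connects any two weights through the highest one (`le_of_invariant`), which gives
irreducibility. The dimensions `k - 2γ + 1` tell the spaces apart.

*The decomposition.* Choose elements of `Sp(n)` that translate the highest weight vector of `W` to
a basis of `primitives n (k - γ) γ`. Left translations commute with the right action, so the
corresponding translates of `W` define an intertwining map from a direct sum of copies of the
spaces `W` to the harmonic functions (`translateSum`). It is injective, as `E` reduces a linear
relation to one between highest weight vectors (`eq_zero_of_sum_weightPoly`), and surjective, as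
primitive polynomials generate the harmonic ones under `F` (`harmBideg_le_of_primitives_le`).
-/

namespace QuatHarm

open MvPolynomial

variable {n : ℕ}

/-! ### The Fischer inner product on polynomials -/

section Fischer

variable {σ : Type*} [Fintype σ]

/-- The Fischer inner product `∑ s, s! * conj (coeff s p) * coeff s q` on complex polynomials,
for which multiplication by a variable is adjoint to the corresponding partial derivative. -/
noncomputable def fischer (p q : MvPolynomial σ ℂ) : ℂ :=
  ∑ s ∈ p.support, conj (coeff s p) * coeff s q * ((∏ v, (s v).factorial : ℕ) : ℂ)

theorem fischer_eq_sum {p : MvPolynomial σ ℂ} {T : Finset (σ →₀ ℕ)} (hT : p.support ⊆ T)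
    (q : MvPolynomial σ ℂ) :
    fischer p q = ∑ s ∈ T, conj (coeff s p) * coeff s q * ((∏ v, (s v).factorial : ℕ) : ℂ) :=
  Finset.sum_subset hT fun s _ hs => by
    rw [notMem_support_iff.1 hs]; simp

theorem fischer_add_left (p p' q : MvPolynomial σ ℂ) :
    fischer (p + p') q = fischer p q + fischer p' q := by
  classical
  rw [fischer_eq_sum (support_add (p := p) (q := p')),
    fischer_eq_sum (Finset.subset_union_left (s₂ := p'.support)) q,
    fischer_eq_sum (Finset.subset_union_right (s₁ := p.support)) q, ← Finset.sum_add_distrib]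
  refine Finset.sum_congr rfl fun s _ => ?_
  rw [coeff_add, map_add]
  ring

theorem fischer_smul_left (c : ℂ) (p q : MvPolynomial σ ℂ) :
    fischer (c • p) q = conj c * fischer p q := by
  rw [fischer_eq_sum (support_smul (a := c) (f := p)), fischer, Finset.mul_sum]
  refine Finset.sum_congr rfl fun s _ => ?_
  rw [coeff_smul, smul_eq_mul, map_mul]
  ring

theorem fischer_add_right (p q q' : MvPolynomial σ ℂ) :
    fischer p (q + q') = fischer p q + fischer p q' := by
  simp only [fischer, coeff_add, mul_add, add_mul, Finset.sum_add_distrib]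

theorem fischer_smul_right (c : ℂ) (p q : MvPolynomial σ ℂ) :
    fischer p (c • q) = c * fischer p q := by
  rw [fischer, fischer, Finset.mul_sum]
  refine Finset.sum_congr rfl fun s _ => ?_
  rw [coeff_smul, smul_eq_mul]
  ring

theorem fischer_conj (p q : MvPolynomial σ ℂ) : conj (fischer q p) = fischer p q := by
  classical
  rw [fischer_eq_sum (Finset.subset_union_left (s₂ := q.support)) q,
    fischer_eq_sum (Finset.subset_union_right (s₁ := p.support)) p, map_sum]
  refine Finset.sum_congr rfl fun s _ => ?_
  simp only [map_mul, Complex.conj_conj, map_natCast]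
  ring

theorem fischer_self (p : MvPolynomial σ ℂ) :
    fischer p p =
      ((∑ s ∈ p.support, Complex.normSq (coeff s p) * (∏ v, (s v).factorial : ℕ) : ℝ) : ℂ) := by
  rw [fischer, Complex.ofReal_sum]
  refine Finset.sum_congr rfl fun s _ => ?_
  rw [Complex.ofReal_mul, Complex.normSq_eq_conj_mul_self, Complex.ofReal_natCast]

theorem fischer_self_re_nonneg (p : MvPolynomial σ ℂ) : 0 ≤ (fischer p p).re := by
  rw [fischer_self, Complex.ofReal_re]
  exact Finset.sum_nonneg fun s _ => mul_nonneg (Complex.normSq_nonneg _) (Nat.cast_nonneg _)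

theorem eq_zero_of_fischer_self {p : MvPolynomial σ ℂ} (h : (fischer p p).re = 0) : p = 0 := by
  rw [fischer_self, Complex.ofReal_re, Finset.sum_eq_zero_iff_of_nonneg
    fun s _ => mul_nonneg (Complex.normSq_nonneg _) (Nat.cast_nonneg _)] at h
  by_contra hp
  obtain ⟨s, hs⟩ := Finset.nonempty_iff_ne_empty.2 (mt support_eq_empty.1 hp)
  have h1 := h s hs
  rw [mul_eq_zero, Complex.normSq_eq_zero, Nat.cast_eq_zero, Finset.prod_eq_zero_iff] at h1
  rcases h1 with h1 | ⟨v, -, h1⟩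
  · exact mem_support_iff.1 hs h1
  · exact Nat.factorial_ne_zero _ h1

/-- The Fischer product as a positive definite inner product. -/
noncomputable abbrev fischerCore : InnerProductSpace.Core ℂ (MvPolynomial σ ℂ) where
  inner := fischer
  conj_inner_symm := fischer_conj
  re_inner_nonneg := fischer_self_re_nonneg
  add_left := fischer_add_left
  smul_left p q c := fischer_smul_left c p q
  definite p h := eq_zero_of_fischer_self (by rw [h, Complex.zero_re])

@[simp]
theorem fischer_zero_left (q : MvPolynomial σ ℂ) : fischer 0 q = 0 := by
  simp [fischer]

@[simp]
theorem fischer_zero_right (p : MvPolynomial σ ℂ) : fischer p 0 = 0 := by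
  simp [fischer]

theorem fischer_sub_right (p q q' : MvPolynomial σ ℂ) :
    fischer p (q - q') = fischer p q - fischer p q' := by
  rw [sub_eq_add_neg, ← neg_one_smul ℂ q', fischer_add_right, fischer_smul_right]
  ring

theorem fischer_sub_left (p p' q : MvPolynomial σ ℂ) :
    fischer (p - p') q = fischer p q - fischer p' q := by
  rw [← fischer_conj, fischer_sub_right, map_sub, fischer_conj, fischer_conj]

theorem fischer_sum_left {κ : Type*} (T : Finset κ) (f : κ → MvPolynomial σ ℂ)
    (q : MvPolynomial σ ℂ) : fischer (∑ i ∈ T, f i) q = ∑ i ∈ T, fischer (f i) q := by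
  classical
  induction T using Finset.induction_on with
  | empty => simp
  | insert i T hi ih => rw [Finset.sum_insert hi, Finset.sum_insert hi, fischer_add_left, ih]

theorem fischer_sum_right {κ : Type*} (T : Finset κ) (p : MvPolynomial σ ℂ)
    (f : κ → MvPolynomial σ ℂ) : fischer p (∑ i ∈ T, f i) = ∑ i ∈ T, fischer p (f i) := by
  classical
  induction T using Finset.induction_on with
  | empty => simp
  | insert i T hi ih => rw [Finset.sum_insert hi, Finset.sum_insert hi, fischer_add_right, ih]

theorem fischer_monomial (s : σ →₀ ℕ) (a : ℂ) (q : MvPolynomial σ ℂ) :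
    fischer (monomial s a) q = conj a * coeff s q * ((∏ v, (s v).factorial : ℕ) : ℂ) := by
  classical
  rw [fischer_eq_sum (support_monomial_subset (s := s) (a := a)), Finset.sum_singleton,
    coeff_monomial, if_pos rfl]

theorem fischer_X_mul (v : σ) (p q : MvPolynomial σ ℂ) :
    fischer (X v * p) q = fischer p (pderiv v q) := by
  classical
  induction p using MvPolynomial.induction_on' with
  | add p p' hp hp' => rw [mul_add, fischer_add_left, fischer_add_left, hp, hp']
  | monomial s a =>
    rw [X, monomial_mul, one_mul, fischer_monomial, fischer_monomial, coeff_pderiv, add_comm _ s]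
    have h : (∏ u, ((s + Finsupp.single v 1 : σ →₀ ℕ) u).factorial)
        = (s v + 1) * ∏ u, (s u).factorial := by
      rw [← Finset.mul_prod_erase _ _ (Finset.mem_univ v),
        ← Finset.mul_prod_erase _ (fun u => (s u).factorial) (Finset.mem_univ v)]
      rw [Finset.prod_congr (g := fun u => (s u).factorial) rfl fun u hu => by
        simp [(Finset.ne_of_mem_erase hu).symm]]
      simp [Nat.factorial_succ, mul_assoc]
    rw [h]
    push_cast
    ring

theorem fischer_pderiv_left (v : σ) (p q : MvPolynomial σ ℂ) :
    fischer (pderiv v p) q = fischer p (X v * q) := by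
  rw [← fischer_conj, ← fischer_X_mul, fischer_conj]

theorem fischer_one_left (q : MvPolynomial σ ℂ) : fischer 1 q = coeff 0 q := by
  rw [← C_1, C_apply, fischer_monomial]
  simp

/-- A finite-dimensional subspace `S` of `A` whose Fischer orthogonal complement in `A` is trivial
is all of `A`. -/
theorem eq_of_forall_fischer_eq_zero {S A : Submodule ℂ (MvPolynomial σ ℂ)}
    [FiniteDimensional ℂ S] (hSA : S ≤ A)
    (h : ∀ f ∈ A, (∀ s ∈ S, fischer s f = 0) → f = 0) : S = A := by
  refine le_antisymm hSA fun f hf => ?_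
  let : NormedAddCommGroup (MvPolynomial σ ℂ) := fischerCore.toNormedAddCommGroup
  let : InnerProductSpace ℂ (MvPolynomial σ ℂ) := InnerProductSpace.ofCore fischerCore.toCore
  obtain ⟨y, hy, z, hz, rfl⟩ := S.exists_add_mem_mem_orthogonal f
  have hzA : z ∈ A := by simpa using A.sub_mem hf (hSA hy)
  have hz0 : z = 0 := h z hzA fun s hs => (Submodule.mem_orthogonal S z).1 hz s hs
  rwa [hz0, add_zero]

end Fischer

/-- Coefficients can be extracted from a polynomial curve modulo a subspace: if `∑ tⁱ vᵢ` lies in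
`S` for infinitely many `t`, then each `vᵢ` lies in `S`. -/
theorem mem_of_forall_sum_pow_smul_mem {M : Type*} [AddCommGroup M] [Module ℂ M]
    (S : Submodule ℂ M) {T : Set ℂ} (hT : T.Infinite) (m : ℕ) (v : ℕ → M)
    (h : ∀ t ∈ T, ∑ i ∈ Finset.range m, t ^ i • v i ∈ S) (i : ℕ) (hi : i < m) : v i ∈ S := by
  rw [← Submodule.Quotient.mk_eq_zero S, ← Module.forall_dual_apply_eq_zero_iff ℂ]
  intro φ
  let P : Polynomial ℂ := ∑ i ∈ Finset.range m,
    Polynomial.monomial i (φ (Submodule.Quotient.mk (v i)))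
  have hP : P = 0 := by
    refine Polynomial.eq_zero_of_infinite_isRoot P (hT.mono fun t ht => ?_)
    have h1 : φ (S.mkQ (∑ i ∈ Finset.range m, t ^ i • v i)) = 0 := by
      rw [Submodule.mkQ_apply, (Submodule.Quotient.mk_eq_zero S).2 (h t ht), map_zero]
    rw [map_sum, map_sum] at h1
    change P.eval t = 0
    rw [← h1, Polynomial.eval_finsetSum]
    refine Finset.sum_congr rfl fun j _ => ?_
    rw [Polynomial.eval_monomial, map_smul, map_smul, smul_eq_mul, mul_comm]
    rfl
  have h2 : P.coeff i = φ (Submodule.Quotient.mk (v i)) := by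
    simp only [P, Polynomial.finsetSum_coeff, Polynomial.coeff_monomial]
    rw [Finset.sum_ite_eq' , if_pos (Finset.mem_range.2 hi)]
  rw [← h2, hP, Polynomial.coeff_zero]

/-! ### Bidegrees, the operators of `𝔰𝔩(2)` and the quadratic form -/

/-- The polynomials that are homogeneous of degree `p` in the coordinates and of degree `q` in
their conjugates. -/
noncomputable def bideg (n p q : ℕ) : Submodule ℂ (Poly n) :=
  weightedHomogeneousSubmodule ℂ (Sum.elim (fun _ => 1) (fun _ => 0)) p ⊓
    weightedHomogeneousSubmodule ℂ (Sum.elim (fun _ => 0) (fun _ => 1)) q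

theorem mul_mem_bideg {p q p' q' : ℕ} {f g : Poly n} (hf : f ∈ bideg n p q)
    (hg : g ∈ bideg n p' q') : f * g ∈ bideg n (p + p') (q + q') :=
  ⟨IsWeightedHomogeneous.mul hf.1 hg.1, IsWeightedHomogeneous.mul hf.2 hg.2⟩

theorem pow_mem_bideg {p q : ℕ} {f : Poly n} (hf : f ∈ bideg n p q) (r : ℕ) :
    f ^ r ∈ bideg n (r * p) (r * q) :=
  ⟨IsWeightedHomogeneous.pow hf.1 r, IsWeightedHomogeneous.pow hf.2 r⟩

theorem X_inl_mem_bideg (c : Fin n ⊕ Fin n) : (X (Sum.inl c) : Poly n) ∈ bideg n 1 0 :=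
  ⟨isWeightedHomogeneous_X _ _ _, isWeightedHomogeneous_X _ _ _⟩

theorem X_inr_mem_bideg (c : Fin n ⊕ Fin n) : (X (Sum.inr c) : Poly n) ∈ bideg n 0 1 :=
  ⟨isWeightedHomogeneous_X _ _ _, isWeightedHomogeneous_X _ _ _⟩

theorem X_inl_mul_mem_bideg (c : Fin n ⊕ Fin n) {p q : ℕ} {f : Poly n} (hf : f ∈ bideg n p q) :
    X (Sum.inl c) * f ∈ bideg n (p + 1) q := by
  simpa [add_comm] using mul_mem_bideg (X_inl_mem_bideg c) hf

theorem X_inr_mul_mem_bideg (c : Fin n ⊕ Fin n) {p q : ℕ} {f : Poly n} (hf : f ∈ bideg n p q) :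
    X (Sum.inr c) * f ∈ bideg n p (q + 1) := by
  simpa [add_comm] using mul_mem_bideg (X_inr_mem_bideg c) hf

theorem pderiv_inl_mem_bideg (c : Fin n ⊕ Fin n) {p q : ℕ} {f : Poly n}
    (hf : f ∈ bideg n (p + 1) q) : pderiv (Sum.inl c) f ∈ bideg n p q :=
  ⟨IsWeightedHomogeneous.pderiv hf.1 rfl, IsWeightedHomogeneous.pderiv hf.2 rfl⟩

theorem pderiv_inr_mem_bideg (c : Fin n ⊕ Fin n) {p q : ℕ} {f : Poly n}
    (hf : f ∈ bideg n p (q + 1)) : pderiv (Sum.inr c) f ∈ bideg n p q :=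
  ⟨IsWeightedHomogeneous.pderiv hf.1 rfl, IsWeightedHomogeneous.pderiv hf.2 rfl⟩

theorem pderiv_eq_zero_of_weight_zero {σ : Type*} {w : σ → ℕ} {f : MvPolynomial σ ℂ}
    (hf : IsWeightedHomogeneous w f 0) {v : σ} (hv : w v ≠ 0) : pderiv v f = 0 := by
  ext s
  rw [coeff_pderiv, hf.coeff_eq_zero, zero_mul, coeff_zero]
  rw [map_add, Finsupp.weight_single]
  simp [hv]

theorem pderiv_inl_eq_zero (c : Fin n ⊕ Fin n) {q : ℕ} {f : Poly n} (hf : f ∈ bideg n 0 q) :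
    pderiv (Sum.inl c) f = 0 :=
  pderiv_eq_zero_of_weight_zero hf.1 one_ne_zero

theorem pderiv_inr_eq_zero (c : Fin n ⊕ Fin n) {p : ℕ} {f : Poly n} (hf : f ∈ bideg n p 0) :
    pderiv (Sum.inr c) f = 0 :=
  pderiv_eq_zero_of_weight_zero hf.2 one_ne_zero

theorem euler_inl {p q : ℕ} {f : Poly n} (hf : f ∈ bideg n p q) :
    ∑ c, X (Sum.inl c) * pderiv (Sum.inl c) f = (p : ℂ) • f := by
  have h := IsWeightedHomogeneous.sum_weight_X_mul_pderiv hf.1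
  simpa [Fintype.sum_sum_type, Nat.cast_smul_eq_nsmul] using h

theorem euler_inr {p q : ℕ} {f : Poly n} (hf : f ∈ bideg n p q) :
    ∑ c, X (Sum.inr c) * pderiv (Sum.inr c) f = (q : ℂ) • f := by
  have h := IsWeightedHomogeneous.sum_weight_X_mul_pderiv hf.2
  simpa [Fintype.sum_sum_type, Nat.cast_smul_eq_nsmul] using h

theorem derivation_sum_apply {κ : Type*} (T : Finset κ) (D : κ → Derivation ℂ (Poly n) (Poly n))
    (f : Poly n) : (∑ i ∈ T, D i) f = ∑ i ∈ T, D i f := by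
  classical
  induction T using Finset.induction_on with
  | empty => simp
  | insert i T hi ih => rw [Finset.sum_insert hi, Finset.sum_insert hi, Derivation.add_apply, ih]

/-- The derivation `E` with `z̄ ↦ w` and `w̄ ↦ -z`: the raising operator of the action of
`𝔰𝔩(2, ℂ)` given by the differential of the right action. -/
noncomputable def raiseOp (n : ℕ) : Derivation ℂ (Poly n) (Poly n) :=
  ∑ i : Fin n, ((X (Sum.inl (Sum.inr i)) : Poly n) • pderiv (Sum.inr (Sum.inl i))
    - (X (Sum.inl (Sum.inl i)) : Poly n) • pderiv (Sum.inr (Sum.inr i)))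

/-- The derivation `F` with `w ↦ z̄` and `z ↦ -w̄`: the lowering operator of the action of
`𝔰𝔩(2, ℂ)` given by the differential of the right action. -/
noncomputable def lowerOp (n : ℕ) : Derivation ℂ (Poly n) (Poly n) :=
  ∑ i : Fin n, ((X (Sum.inr (Sum.inl i)) : Poly n) • pderiv (Sum.inl (Sum.inr i))
    - (X (Sum.inr (Sum.inr i)) : Poly n) • pderiv (Sum.inl (Sum.inl i)))

theorem raiseOp_apply (f : Poly n) : raiseOp n f =
    ∑ i : Fin n, (X (Sum.inl (Sum.inr i)) * pderiv (Sum.inr (Sum.inl i)) f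
      - X (Sum.inl (Sum.inl i)) * pderiv (Sum.inr (Sum.inr i)) f) := by
  simp [raiseOp, derivation_sum_apply]

theorem lowerOp_apply (f : Poly n) : lowerOp n f =
    ∑ i : Fin n, (X (Sum.inr (Sum.inl i)) * pderiv (Sum.inl (Sum.inr i)) f
      - X (Sum.inr (Sum.inr i)) * pderiv (Sum.inl (Sum.inl i)) f) := by
  simp [lowerOp, derivation_sum_apply]

theorem raiseOp_X_inl (c : Fin n ⊕ Fin n) : raiseOp n (X (Sum.inl c)) = 0 := by
  simp [raiseOp_apply, pderiv_X]

theorem raiseOp_X_inr_inl (i : Fin n) :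
    raiseOp n (X (Sum.inr (Sum.inl i))) = X (Sum.inl (Sum.inr i)) := by
  simp [raiseOp_apply, pderiv_X, Pi.single_apply]

theorem raiseOp_X_inr_inr (i : Fin n) :
    raiseOp n (X (Sum.inr (Sum.inr i))) = - X (Sum.inl (Sum.inl i)) := by
  simp [raiseOp_apply, pderiv_X, Pi.single_apply]

theorem lowerOp_X_inr (c : Fin n ⊕ Fin n) : lowerOp n (X (Sum.inr c)) = 0 := by
  simp [lowerOp_apply, pderiv_X]

theorem lowerOp_X_inl_inr (i : Fin n) :
    lowerOp n (X (Sum.inl (Sum.inr i))) = X (Sum.inr (Sum.inl i)) := by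
  simp [lowerOp_apply, pderiv_X, Pi.single_apply]

theorem lowerOp_X_inl_inl (i : Fin n) :
    lowerOp n (X (Sum.inl (Sum.inl i))) = - X (Sum.inr (Sum.inr i)) := by
  simp [lowerOp_apply, pderiv_X, Pi.single_apply]

theorem raiseOp_mem_bideg {p q : ℕ} {f : Poly n} (hf : f ∈ bideg n p (q + 1)) :
    raiseOp n f ∈ bideg n (p + 1) q := by
  rw [raiseOp_apply]
  exact Submodule.sum_mem _ fun i _ => Submodule.sub_mem _
    (X_inl_mul_mem_bideg _ (pderiv_inr_mem_bideg _ hf))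
    (X_inl_mul_mem_bideg _ (pderiv_inr_mem_bideg _ hf))

theorem lowerOp_mem_bideg {p q : ℕ} {f : Poly n} (hf : f ∈ bideg n (p + 1) q) :
    lowerOp n f ∈ bideg n p (q + 1) := by
  rw [lowerOp_apply]
  exact Submodule.sum_mem _ fun i _ => Submodule.sub_mem _
    (X_inr_mul_mem_bideg _ (pderiv_inl_mem_bideg _ hf))
    (X_inr_mul_mem_bideg _ (pderiv_inl_mem_bideg _ hf))

theorem raiseOp_eq_zero {p : ℕ} {f : Poly n} (hf : f ∈ bideg n p 0) : raiseOp n f = 0 := by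
  simp [raiseOp_apply, pderiv_inr_eq_zero _ hf]

theorem fischer_raiseOp_left (f g : Poly n) :
    fischer (raiseOp n f) g = fischer f (lowerOp n g) := by
  rw [raiseOp_apply, lowerOp_apply, fischer_sum_left, fischer_sum_right]
  refine Finset.sum_congr rfl fun i _ => ?_
  rw [fischer_sub_left, fischer_sub_right, fischer_X_mul, fischer_X_mul, fischer_pderiv_left,
    fischer_pderiv_left]

theorem fischer_lowerOp_left (f g : Poly n) :
    fischer (lowerOp n f) g = fischer f (raiseOp n g) := by
  rw [← fischer_conj, ← fischer_raiseOp_left, fischer_conj]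

theorem raiseOp_lowerOp_sub (f : Poly n) : raiseOp n (lowerOp n f) - lowerOp n (raiseOp n f) =
    ∑ c, X (Sum.inl c) * pderiv (Sum.inl c) f - ∑ c, X (Sum.inr c) * pderiv (Sum.inr c) f := by
  have h : ⁅raiseOp n, lowerOp n⁆ = ∑ c, (X (Sum.inl c) : Poly n) • pderiv (Sum.inl c)
      - ∑ c, (X (Sum.inr c) : Poly n) • pderiv (Sum.inr c) := by
    refine derivation_ext fun v => ?_
    rw [Derivation.commutator_apply]
    rcases v with (i | i) | (i | i) <;>
      simp [raiseOp_X_inl, raiseOp_X_inr_inl, raiseOp_X_inr_inr, lowerOp_X_inr,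
        lowerOp_X_inl_inl, lowerOp_X_inl_inr, derivation_sum_apply, pderiv_X, Pi.single_apply]
  have h2 := congrArg (fun D => D f) h
  simpa [Derivation.commutator_apply, derivation_sum_apply] using h2

/-- The commutator `[E, F]` acts on bidegree `(p, q)` by the weight `p - q`. -/
theorem raiseOp_lowerOp {p q : ℕ} {f : Poly n} (hf : f ∈ bideg n p q) :
    raiseOp n (lowerOp n f) = lowerOp n (raiseOp n f) + ((p : ℂ) - q) • f := by
  rw [← sub_eq_iff_eq_add', raiseOp_lowerOp_sub, euler_inl hf, euler_inr hf, sub_smul]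

/-- The polynomial `∑ c c̄`, the square of the Euclidean norm. -/
noncomputable def quad (n : ℕ) : Poly n := ∑ c, X (Sum.inl c) * X (Sum.inr c)

theorem quad_mem_bideg : quad n ∈ bideg n 1 1 :=
  Submodule.sum_mem _ fun c _ => X_inl_mul_mem_bideg c (X_inr_mem_bideg c)

theorem quad_ne_zero (hn : 0 < n) : quad n ≠ 0 := by
  intro h
  have h1 := congrArg (fun f => eval (fun v => Sum.elim (Pi.single (Sum.inl ⟨0, hn⟩) 1)
    (Pi.single (Sum.inl ⟨0, hn⟩) 1) v) f) h
  simp [quad, Pi.single_apply] at h1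

theorem raiseOp_quad_mul (f : Poly n) : raiseOp n (quad n * f) = quad n * raiseOp n f := by
  have h : raiseOp n (quad n) = 0 := by
    simp only [quad, map_sum, map_add, Derivation.leibniz, raiseOp_X_inl, smul_eq_mul,
      mul_zero, add_zero, Fintype.sum_sum_type, raiseOp_X_inr_inl, raiseOp_X_inr_inr]
    rw [← Finset.sum_add_distrib]
    exact Finset.sum_eq_zero fun i _ => by ring
  rw [Derivation.leibniz, h, smul_zero, add_zero, smul_eq_mul]

theorem lowerOp_quad_mul (f : Poly n) : lowerOp n (quad n * f) = quad n * lowerOp n f := by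
  have h : lowerOp n (quad n) = 0 := by
    simp only [quad, map_sum, map_add, Derivation.leibniz, lowerOp_X_inr, smul_eq_mul,
      mul_zero, zero_add, Fintype.sum_sum_type, lowerOp_X_inl_inl, lowerOp_X_inl_inr]
    rw [← Finset.sum_add_distrib]
    exact Finset.sum_eq_zero fun i _ => by ring
  rw [Derivation.leibniz, h, smul_zero, add_zero, smul_eq_mul]

theorem laplacian_eq_sum (f : Poly n) : laplacian n f =
    (4 : ℂ) • ∑ c : Fin n ⊕ Fin n, pderiv (Sum.inl c) (pderiv (Sum.inr c) f) := by
  simp [laplacian]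

/-- The Laplacian is adjoint to the multiplication by `4 * quad`. -/
theorem fischer_laplacian_right (f g : Poly n) :
    fischer g (laplacian n f) = 4 * fischer (quad n * g) f := by
  rw [laplacian_eq_sum, fischer_smul_right, fischer_sum_right, quad, Finset.sum_mul,
    fischer_sum_left]
  congr 1
  refine Finset.sum_congr rfl fun c _ => ?_
  rw [mul_comm (X (Sum.inl c)), mul_assoc, fischer_X_mul, fischer_X_mul]

/-- The adjoint statement is that `F` commutes with the multiplication by `quad`. -/
theorem laplacian_raiseOp (f : Poly n) :
    laplacian n (raiseOp n f) = raiseOp n (laplacian n f) := by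
  rw [← sub_eq_zero]
  refine eq_zero_of_fischer_self ?_
  rw [fischer_sub_right, fischer_laplacian_right, ← fischer_lowerOp_left,
    ← fischer_lowerOp_left, fischer_laplacian_right, lowerOp_quad_mul, sub_self, Complex.zero_re]

theorem laplacian_lowerOp (f : Poly n) :
    laplacian n (lowerOp n f) = lowerOp n (laplacian n f) := by
  rw [← sub_eq_zero]
  refine eq_zero_of_fischer_self ?_
  rw [fischer_sub_right, fischer_laplacian_right, ← fischer_raiseOp_left,
    ← fischer_raiseOp_left, fischer_laplacian_right, raiseOp_quad_mul, sub_self, Complex.zero_re]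

theorem laplacian_mem_bideg {p q : ℕ} {f : Poly n} (hf : f ∈ bideg n (p + 1) (q + 1)) :
    laplacian n f ∈ bideg n p q := by
  rw [laplacian_apply]
  exact Submodule.smul_mem _ _ (Submodule.sum_mem _ fun i _ => Submodule.add_mem _
    (pderiv_inl_mem_bideg _ (pderiv_inr_mem_bideg _ hf))
    (pderiv_inl_mem_bideg _ (pderiv_inr_mem_bideg _ hf)))

theorem laplacian_eq_zero_of_right {p : ℕ} {f : Poly n} (hf : f ∈ bideg n p 0) :
    laplacian n f = 0 := by
  simp [laplacian_apply, pderiv_inr_eq_zero _ hf]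

theorem laplacian_eq_zero_of_left {q : ℕ} {f : Poly n} (hf : f ∈ bideg n 0 q) :
    laplacian n f = 0 := by
  simp [laplacian_apply, pderiv_comm n (Sum.inl _) (Sum.inr _), pderiv_inl_eq_zero _ hf]

/-- The harmonic polynomials of bidegree `(p, q)`. -/
noncomputable def harmBideg (n p q : ℕ) : Submodule ℂ (Poly n) :=
  bideg n p q ⊓ LinearMap.ker (laplacian n)

/-- The harmonic polynomials of bidegree `(p, q)` that are killed by the raising operator. -/
noncomputable def primitives (n p q : ℕ) : Submodule ℂ (Poly n) :=
  harmBideg n p q ⊓ LinearMap.ker (raiseOp n).toLinearMap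

theorem mem_harmBideg {p q : ℕ} {f : Poly n} :
    f ∈ harmBideg n p q ↔ f ∈ bideg n p q ∧ laplacian n f = 0 := Iff.rfl

theorem mem_primitives {p q : ℕ} {f : Poly n} :
    f ∈ primitives n p q ↔ (f ∈ bideg n p q ∧ laplacian n f = 0) ∧ raiseOp n f = 0 := Iff.rfl

theorem raiseOp_mem_harmBideg {p q : ℕ} {f : Poly n} (hf : f ∈ harmBideg n p (q + 1)) :
    raiseOp n f ∈ harmBideg n (p + 1) q := by
  rw [mem_harmBideg] at hf ⊢
  exact ⟨raiseOp_mem_bideg hf.1, by rw [laplacian_raiseOp, hf.2, map_zero]⟩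

theorem lowerOp_mem_harmBideg {p q : ℕ} {f : Poly n} (hf : f ∈ harmBideg n (p + 1) q) :
    lowerOp n f ∈ harmBideg n p (q + 1) := by
  rw [mem_harmBideg] at hf ⊢
  exact ⟨lowerOp_mem_bideg hf.1, by rw [laplacian_lowerOp, hf.2, map_zero]⟩

/-! ### Dimensions of the spaces of primitive harmonic polynomials -/

theorem mem_bideg_iff {p q : ℕ} {f : Poly n} : f ∈ bideg n p q ↔ ∀ s, coeff s f ≠ 0 →
    ∑ c, s (Sum.inl c) = p ∧ ∑ c, s (Sum.inr c) = q := by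
  have hw : ∀ (w : (Fin n ⊕ Fin n) ⊕ (Fin n ⊕ Fin n) → ℕ)
      (s : (Fin n ⊕ Fin n) ⊕ (Fin n ⊕ Fin n) →₀ ℕ), Finsupp.weight w s = ∑ v, s v * w v := by
    intro w s
    rw [Finsupp.weight_apply, Finsupp.sum_fintype _ _ (by simp)]
    simp
  constructor
  · rintro ⟨h1, h2⟩ s hs
    have g1 := h1 hs
    have g2 := h2 hs
    rw [hw, Fintype.sum_sum_type] at g1 g2
    simpa using And.intro g1 g2
  · intro h
    refine ⟨fun s hs => ?_, fun s hs => ?_⟩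
    · rw [hw, Fintype.sum_sum_type, ← (h s hs).1]
      simp
    · rw [hw, Fintype.sum_sum_type, ← (h s hs).2]
      simp

theorem monomial_mem_bideg {p q : ℕ} {s : (Fin n ⊕ Fin n) ⊕ (Fin n ⊕ Fin n) →₀ ℕ}
    (h1 : ∑ c, s (Sum.inl c) = p) (h2 : ∑ c, s (Sum.inr c) = q) (a : ℂ) :
    monomial s a ∈ bideg n p q := by
  classical
  rw [mem_bideg_iff]
  intro t ht
  rw [coeff_monomial] at ht
  by_cases h : s = t
  · rw [← h]
    exact ⟨h1, h2⟩
  · rw [if_neg h] at ht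
    exact absurd rfl ht

/-- The monomials of bidegree `(p, q)`, indexed by pairs of exponents. -/
noncomputable def bidegMonomial (n p q : ℕ)
    (s : (Finset.univ : Finset (Fin n ⊕ Fin n)).finsuppAntidiag p ×
      (Finset.univ : Finset (Fin n ⊕ Fin n)).finsuppAntidiag q) : Poly n :=
  monomial (Finsupp.sumElim s.1.1 s.2.1) 1

theorem span_bidegMonomial (p q : ℕ) :
    Submodule.span ℂ (Set.range (bidegMonomial n p q)) = bideg n p q := by
  refine le_antisymm ?_ fun f hf => ?_
  · rw [Submodule.span_le]
    rintro _ ⟨s, rfl⟩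
    have h1 := (Finset.mem_finsuppAntidiag.1 s.1.2).1
    have h2 := (Finset.mem_finsuppAntidiag.1 s.2.2).1
    exact monomial_mem_bideg (by simpa using h1) (by simpa using h2) 1
  · rw [f.as_sum]
    refine Submodule.sum_mem _ fun s hs => ?_
    obtain ⟨h1, h2⟩ := mem_bideg_iff.1 hf s (mem_support_iff.1 hs)
    have h3 : monomial s (coeff s f) = coeff s f • monomial s (1 : ℂ) := by
      rw [smul_monomial, smul_eq_mul, mul_one]
    rw [h3]
    refine Submodule.smul_mem _ _ (Submodule.subset_span
      ⟨(⟨(Finsupp.sumFinsuppEquivProdFinsupp s).1, ?_⟩,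
        ⟨(Finsupp.sumFinsuppEquivProdFinsupp s).2, ?_⟩), ?_⟩)
    · exact Finset.mem_finsuppAntidiag.2 ⟨by simpa using h1, Finset.subset_univ _⟩
    · exact Finset.mem_finsuppAntidiag.2 ⟨by simpa using h2, Finset.subset_univ _⟩
    · exact congrArg (fun t => monomial t (1 : ℂ))
        (Finsupp.sumFinsuppEquivProdFinsupp.symm_apply_apply s)

theorem linearIndependent_bidegMonomial (p q : ℕ) :
    LinearIndependent ℂ (bidegMonomial n p q) := by
  have h := (basisMonomials ((Fin n ⊕ Fin n) ⊕ (Fin n ⊕ Fin n)) ℂ).linearIndependent.comp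
    (fun s : (Finset.univ : Finset (Fin n ⊕ Fin n)).finsuppAntidiag p ×
      (Finset.univ : Finset (Fin n ⊕ Fin n)).finsuppAntidiag q => Finsupp.sumElim s.1.1 s.2.1)
    (by
      rintro ⟨⟨a, ha⟩, ⟨b, hb⟩⟩ ⟨⟨a', ha'⟩, ⟨b', hb'⟩⟩ hs
      have h2 := Finsupp.sumFinsuppEquivProdFinsupp.symm.injective
        (a₁ := (a, b)) (a₂ := (a', b')) hs
      simpa using h2)
  rw [coe_basisMonomials] at h
  exact h

instance finiteDimensional_bideg (p q : ℕ) : FiniteDimensional ℂ (bideg n p q) := by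
  rw [← span_bidegMonomial]
  exact FiniteDimensional.span_of_finite ℂ (Set.finite_range _)

theorem finrank_bideg (p q : ℕ) : Module.finrank ℂ (bideg n p q) =
    Nat.multichoose (2 * n) p * Nat.multichoose (2 * n) q := by
  rw [← span_bidegMonomial, finrank_span_eq_card (linearIndependent_bidegMonomial p q),
    Fintype.card_prod, Fintype.card_coe, Fintype.card_coe,
    Finset.card_finsuppAntidiag_nat_eq_multichoose, Finset.card_finsuppAntidiag_nat_eq_multichoose]
  simp [two_mul]

instance finiteDimensional_harmBideg (p q : ℕ) : FiniteDimensional ℂ (harmBideg n p q) :=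
  Submodule.finiteDimensional_of_le (inf_le_left : harmBideg n p q ≤ bideg n p q)

instance finiteDimensional_primitives (p q : ℕ) : FiniteDimensional ℂ (primitives n p q) :=
  Submodule.finiteDimensional_of_le (inf_le_left : primitives n p q ≤ harmBideg n p q)

/-- Rank and nullity for the restriction of a linear map to a finite-dimensional subspace. -/
theorem finrank_inf_ker_add {M : Type*} [AddCommGroup M] [Module ℂ M] (S : Submodule ℂ M)
    [FiniteDimensional ℂ S] (g : M →ₗ[ℂ] M) :
    Module.finrank ℂ (S.map g) + Module.finrank ℂ ↥(S ⊓ LinearMap.ker g) =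
      Module.finrank ℂ S := by
  have h := (g.domRestrict S).finrank_range_add_finrank_ker
  rw [LinearMap.range_domRestrict] at h
  have h2 : LinearMap.ker (g.domRestrict S) = (S ⊓ LinearMap.ker g).comap S.subtype := by
    ext x
    simp
  rw [h2, (Submodule.comapSubtypeEquivOfLe
    (inf_le_left : S ⊓ LinearMap.ker g ≤ S)).finrank_eq] at h
  exact h

/-- The Laplacian is surjective on polynomials of given bidegree, because its adjoint, the
multiplication by `quad`, is injective. -/
theorem map_laplacian_bideg (hn : 0 < n) (p q : ℕ) :
    (bideg n (p + 1) (q + 1)).map (laplacian n) = bideg n p q := by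
  refine eq_of_forall_fischer_eq_zero ?_ fun f hf h => ?_
  · rintro _ ⟨f, hf, rfl⟩
    exact laplacian_mem_bideg hf
  · have h1 : quad n * f ∈ bideg n (p + 1) (q + 1) := by
      simpa [add_comm] using mul_mem_bideg quad_mem_bideg hf
    have h2 := h _ ⟨_, h1, rfl⟩
    rw [← fischer_conj, fischer_laplacian_right, map_mul, fischer_conj] at h2
    have h3 : fischer (quad n * f) (quad n * f) = 0 := by simpa using h2
    have h4 := eq_zero_of_fischer_self (by rw [h3, Complex.zero_re])
    exact (mul_eq_zero.1 h4).resolve_left (quad_ne_zero hn)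

/-- The raising operator is injective in negative weights. -/
theorem eq_zero_of_raiseOp_eq_zero {p q : ℕ} (hpq : p < q) {f : Poly n} (hf : f ∈ bideg n p q)
    (h : raiseOp n f = 0) : f = 0 := by
  have h1 := raiseOp_lowerOp hf
  rw [h, map_zero, zero_add] at h1
  have h2 : fischer (lowerOp n f) (lowerOp n f) = (((p : ℝ) - q : ℝ) : ℂ) * fischer f f := by
    rw [fischer_lowerOp_left, h1, fischer_smul_right]
    push_cast
    rfl
  have h3 := congrArg Complex.re h2
  rw [Complex.re_ofReal_mul] at h3
  have hpq' : (p : ℝ) < q := by exact_mod_cast hpq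
  exact eq_zero_of_fischer_self (by
    nlinarith [fischer_self_re_nonneg (lowerOp n f), fischer_self_re_nonneg f])

/-- The lowering operator is injective in positive weights. -/
theorem eq_zero_of_lowerOp_eq_zero {p q : ℕ} (hpq : q < p) {f : Poly n} (hf : f ∈ bideg n p q)
    (h : lowerOp n f = 0) : f = 0 := by
  have h1 := raiseOp_lowerOp hf
  rw [h, map_zero] at h1
  have h2 : fischer (raiseOp n f) (raiseOp n f) = (((q : ℝ) - p : ℝ) : ℂ) * fischer f f := by
    rw [fischer_raiseOp_left, eq_neg_of_add_eq_zero_left h1.symm, ← neg_one_smul ℂ, smul_smul,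
      fischer_smul_right]
    push_cast
    ring
  have h3 := congrArg Complex.re h2
  rw [Complex.re_ofReal_mul] at h3
  have hpq' : (q : ℝ) < p := by exact_mod_cast hpq
  exact eq_zero_of_fischer_self (by
    nlinarith [fischer_self_re_nonneg (raiseOp n f), fischer_self_re_nonneg f])

/-- The raising operator is surjective onto positive weights, because its adjoint, the lowering
operator, is injective there. -/
theorem map_raiseOp_harmBideg {p q : ℕ} (hpq : q ≤ p) :
    (harmBideg n p (q + 1)).map (raiseOp n).toLinearMap = harmBideg n (p + 1) q := by
  refine eq_of_forall_fischer_eq_zero ?_ fun f hf h => ?_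
  · rintro _ ⟨f, hf, rfl⟩
    exact raiseOp_mem_harmBideg hf
  · have h2 : fischer (raiseOp n (lowerOp n f)) f = 0 :=
      h _ ⟨_, lowerOp_mem_harmBideg hf, rfl⟩
    rw [fischer_raiseOp_left] at h2
    exact eq_zero_of_lowerOp_eq_zero (Nat.lt_succ_of_le hpq) hf.1
      (eq_zero_of_fischer_self (by rw [h2, Complex.zero_re]))

theorem finrank_harmBideg_right_zero (p : ℕ) :
    Module.finrank ℂ (harmBideg n p 0) = Nat.multichoose (2 * n) p := by
  have h : harmBideg n p 0 = bideg n p 0 :=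
    inf_eq_left.2 fun f hf => laplacian_eq_zero_of_right hf
  rw [h, finrank_bideg, Nat.multichoose_zero_right, mul_one]

theorem finrank_harmBideg_succ (hn : 0 < n) (p q : ℕ) :
    Nat.multichoose (2 * n) p * Nat.multichoose (2 * n) q +
      Module.finrank ℂ (harmBideg n (p + 1) (q + 1)) =
    Nat.multichoose (2 * n) (p + 1) * Nat.multichoose (2 * n) (q + 1) := by
  have h := finrank_inf_ker_add (bideg n (p + 1) (q + 1)) (laplacian n)
  rwa [map_laplacian_bideg hn, finrank_bideg, finrank_bideg] at h

theorem finrank_primitives_right_zero (p : ℕ) :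
    Module.finrank ℂ (primitives n p 0) = Nat.multichoose (2 * n) p := by
  have h : primitives n p 0 = harmBideg n p 0 :=
    inf_eq_left.2 fun f hf => raiseOp_eq_zero hf.1
  rw [h, finrank_harmBideg_right_zero]

theorem finrank_primitives_succ {p q : ℕ} (hpq : q ≤ p) :
    Module.finrank ℂ (harmBideg n (p + 1) q) + Module.finrank ℂ (primitives n p (q + 1)) =
      Module.finrank ℂ (harmBideg n p (q + 1)) := by
  have h := finrank_inf_ker_add (harmBideg n p (q + 1)) (raiseOp n).toLinearMap
  rwa [map_raiseOp_harmBideg hpq] at h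

theorem cast_multichoose {N : ℕ} (hN : 0 < N) (p : ℕ) : (Nat.multichoose N p : ℚ) =
    (p + N - 1).factorial / (p.factorial * (N - 1).factorial) := by
  rw [Nat.multichoose_eq, Nat.cast_choose ℚ (by omega), add_comm N p]
  congr 4
  omega

/-- The dimension formula for the primitive harmonic polynomials of bidegree `(p, q)`, `q ≤ p`. -/
theorem finrank_primitives (hn : 2 ≤ n) (p q : ℕ) (hpq : q ≤ p) :
    (Module.finrank ℂ (primitives n p q) : ℚ) =
      ((p + 2 * n - 2).factorial * (q + 2 * n - 3).factorial * (p - q + 1) *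
        (p + q + 2 * n - 1)) /
      ((p + 1).factorial * q.factorial * (2 * n - 1).factorial * (2 * n - 3).factorial) := by
  obtain ⟨m, rfl⟩ : ∃ m, n = m + 2 := ⟨n - 2, by omega⟩
  have hm : ∀ r, (Nat.multichoose (2 * (m + 2)) r : ℚ) =
      (r + (2 * m + 1) + 1 + 1).factorial /
        (r.factorial * (2 * m + 1 + 1 + 1).factorial) := fun r =>
    cast_multichoose (by omega) r
  have e1 : 2 * (m + 2) - 1 = 2 * m + 1 + 1 + 1 := by omega
  have e2 : 2 * (m + 2) - 3 = 2 * m + 1 := by omega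
  have e3 : p + 2 * (m + 2) - 2 = p + (2 * m + 1) + 1 := by omega
  have e4 : q + 2 * (m + 2) - 3 = q + (2 * m + 1) := by omega
  rw [e1, e2, e3, e4]
  have hs : ∀ r : ℕ, ((r + 1).factorial : ℚ) = (r + 1) * r.factorial := fun r => by
    rw [Nat.factorial_succ]; push_cast; ring
  have hf : ∀ r : ℕ, (r.factorial : ℚ) ≠ 0 := fun r => Nat.cast_ne_zero.2 r.factorial_ne_zero
  have f1 := hf (2 * m + 1)
  -- Every factorial is expressed through the smallest one of its kind.
  rcases q with _ | _ | q
  · rw [finrank_primitives_right_zero, hm, hs (p + (2 * m + 1) + 1), hs (2 * m + 1 + 1), hs p,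
      zero_add]
    have f2 := hf p
    push_cast
    simp only [Nat.factorial_zero, Nat.cast_one]
    field_simp
    ring
  · obtain ⟨p, rfl⟩ : ∃ p', p = p' + 1 := ⟨p - 1, by omega⟩
    have g1 := finrank_primitives_succ (n := m + 2) (p := p + 1) (q := 0) (by omega)
    have g2 := finrank_harmBideg_succ (n := m + 2) (by omega) p 0
    rw [finrank_harmBideg_right_zero] at g1
    have g1' := congrArg (Nat.cast (R := ℚ)) g1
    have g2' := congrArg (Nat.cast (R := ℚ)) g2
    push_cast at g1' g2'
    rw [hm] at g1'
    rw [hm, hm, hm, hm] at g2'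
    have g3 : (Module.finrank ℂ (primitives (m + 2) (p + 1) (0 + 1)) : ℚ) = _ :=
      (eq_sub_of_add_eq' g1').trans (congrArg (· - _) (eq_sub_of_add_eq' g2'))
    rw [g3]
    have f2 := hf p
    have f3 := hf (p + (2 * m + 1))
    have c1 : p + 1 + (2 * m + 1) = p + (2 * m + 1) + 1 := by omega
    have c2 : p + 1 + 1 + (2 * m + 1) = p + (2 * m + 1) + 1 + 1 := by omega
    have c3 : 0 + 1 + (2 * m + 1) = 2 * m + 1 + 1 := by omega
    have c4 : 0 + (2 * m + 1) = 2 * m + 1 := by omega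
    rw [c2, c1, c3, c4]
    simp only [hs, Nat.factorial_zero]
    push_cast
    field_simp
    ring
  · obtain ⟨p, rfl⟩ : ∃ p', p = p' + 1 := ⟨p - 1, by omega⟩
    have g1 := finrank_primitives_succ (n := m + 2) (p := p + 1) (q := q + 1) (by omega)
    have g2 := finrank_harmBideg_succ (n := m + 2) (by omega) p (q + 1)
    have g3 := finrank_harmBideg_succ (n := m + 2) (by omega) (p + 1) q
    have g1' := congrArg (Nat.cast (R := ℚ)) g1
    have g2' := congrArg (Nat.cast (R := ℚ)) g2
    have g3' := congrArg (Nat.cast (R := ℚ)) g3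
    push_cast at g1' g2' g3'
    rw [hm, hm, hm, hm] at g2' g3'
    have g4 : (Module.finrank ℂ (primitives (m + 2) (p + 1) (q + 1 + 1)) : ℚ) = _ :=
      (eq_sub_of_add_eq' g1').trans
        (congrArg₂ (· - ·) (eq_sub_of_add_eq' g2') (eq_sub_of_add_eq' g3'))
    rw [g4]
    have f2 := hf p
    have f3 := hf (p + (2 * m + 1))
    have f4 := hf q
    have f5 := hf (q + (2 * m + 1))
    have c1 : p + 1 + (2 * m + 1) = p + (2 * m + 1) + 1 := by omega
    have c2 : p + 1 + 1 + (2 * m + 1) = p + (2 * m + 1) + 1 + 1 := by omega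
    have c3 : q + 1 + (2 * m + 1) = q + (2 * m + 1) + 1 := by omega
    have c4 : q + 1 + 1 + (2 * m + 1) = q + (2 * m + 1) + 1 + 1 := by omega
    rw [c2, c1, c4, c3]
    simp only [hs]
    push_cast
    field_simp
    ring

/-! ### Products of linear forms and their Fischer pairing -/

/-- The complex structure `(z, w) ↦ (w, -z)` of `ℂ²ⁿ` that defines the symplectic form. -/
def rot (a : Pt n) : Pt n := Sum.elim (fun i => a (Sum.inr i)) (fun i => - a (Sum.inl i))

/-- The linear form `∑ a_c c` in the coordinates. -/
noncomputable def linX (a : Pt n) : Poly n := ∑ c, a c • X (Sum.inl c)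

/-- The linear form `∑ a_c c̄` in the conjugate coordinates. -/
noncomputable def linY (a : Pt n) : Poly n := ∑ c, a c • X (Sum.inr c)

/-- The invariant of `E` and `F` attached to two vectors, which is `w₂ z̄₁ - w₁ z̄₂` for the first
two vectors of the standard basis. -/
noncomputable def wedge (a b : Pt n) : Poly n := linX b * linY (rot a) - linX a * linY (rot b)

/-- The polynomial that is `w₁ⁱ z̄₁ʲ (w₂ z̄₁ - w₁ z̄₂) ^ q` for the first two vectors of the
standard basis. -/
noncomputable def weightPoly (a b : Pt n) (i j q : ℕ) : Poly n :=
  linX a ^ i * linY (rot a) ^ j * wedge a b ^ q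

theorem linX_mem_bideg (a : Pt n) : linX a ∈ bideg n 1 0 :=
  Submodule.sum_mem _ fun c _ => Submodule.smul_mem _ _ (X_inl_mem_bideg c)

theorem linY_mem_bideg (a : Pt n) : linY a ∈ bideg n 0 1 :=
  Submodule.sum_mem _ fun c _ => Submodule.smul_mem _ _ (X_inr_mem_bideg c)

theorem wedge_mem_bideg (a b : Pt n) : wedge a b ∈ bideg n 1 1 :=
  Submodule.sub_mem _ (mul_mem_bideg (linX_mem_bideg _) (linY_mem_bideg _))
    (mul_mem_bideg (linX_mem_bideg _) (linY_mem_bideg _))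

theorem weightPoly_mem_bideg (a b : Pt n) (i j q : ℕ) :
    weightPoly a b i j q ∈ bideg n (i + q) (j + q) := by
  have h := mul_mem_bideg (mul_mem_bideg (pow_mem_bideg (linX_mem_bideg a) i)
    (pow_mem_bideg (linY_mem_bideg (rot a)) j)) (pow_mem_bideg (wedge_mem_bideg a b) q)
  rw [weightPoly]
  simpa using h

theorem raiseOp_linX (a : Pt n) : raiseOp n (linX a) = 0 := by
  simp [linX, raiseOp_X_inl]

theorem raiseOp_linY_rot (a : Pt n) : raiseOp n (linY (rot a)) = linX a := by
  simp [linX, linY, rot, raiseOp_X_inr_inl, raiseOp_X_inr_inr, add_comm]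

theorem lowerOp_linX (a : Pt n) : lowerOp n (linX a) = linY (rot a) := by
  simp [linX, linY, rot, lowerOp_X_inl_inl, lowerOp_X_inl_inr, add_comm]

theorem lowerOp_linY (a : Pt n) : lowerOp n (linY a) = 0 := by
  simp [linY, lowerOp_X_inr]

theorem raiseOp_wedge (a b : Pt n) : raiseOp n (wedge a b) = 0 := by
  simp only [wedge, map_sub, Derivation.leibniz, raiseOp_linX, raiseOp_linY_rot, smul_eq_mul]
  ring

theorem lowerOp_wedge (a b : Pt n) : lowerOp n (wedge a b) = 0 := by
  simp only [wedge, map_sub, Derivation.leibniz, lowerOp_linX, lowerOp_linY, smul_eq_mul]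
  ring

theorem raiseOp_weightPoly_zero (a b : Pt n) (i q : ℕ) : raiseOp n (weightPoly a b i 0 q) = 0 := by
  simp [weightPoly, Derivation.leibniz, Derivation.leibniz_pow, raiseOp_linX, raiseOp_wedge]

theorem raiseOp_weightPoly_succ (a b : Pt n) (i j q : ℕ) : raiseOp n (weightPoly a b i (j + 1) q) =
    ((j + 1 : ℕ) : ℂ) • weightPoly a b (i + 1) j q := by
  simp only [weightPoly, Derivation.leibniz, Derivation.leibniz_pow, raiseOp_linX, raiseOp_wedge,
    raiseOp_linY_rot, smul_eq_mul, mul_zero, smul_zero, add_zero, zero_add, Nat.add_sub_cancel,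
    Nat.cast_smul_eq_nsmul, nsmul_eq_mul]
  ring

theorem lowerOp_weightPoly_zero (a b : Pt n) (j q : ℕ) : lowerOp n (weightPoly a b 0 j q) = 0 := by
  simp [weightPoly, Derivation.leibniz, Derivation.leibniz_pow, lowerOp_linY, lowerOp_wedge]

theorem lowerOp_weightPoly_succ (a b : Pt n) (i j q : ℕ) : lowerOp n (weightPoly a b (i + 1) j q) =
    ((i + 1 : ℕ) : ℂ) • weightPoly a b i (j + 1) q := by
  simp only [weightPoly, Derivation.leibniz, Derivation.leibniz_pow, lowerOp_linX, lowerOp_wedge,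
    lowerOp_linY, smul_eq_mul, mul_zero, smul_zero, zero_add, Nat.add_sub_cancel,
    Nat.cast_smul_eq_nsmul, nsmul_eq_mul]
  ring

/-- The derivative along `a` in the coordinates. -/
noncomputable def derivX (a : Pt n) : Derivation ℂ (Poly n) (Poly n) :=
  ∑ c, a c • pderiv (Sum.inl c)

/-- The derivative along `a` in the conjugate coordinates. -/
noncomputable def derivY (a : Pt n) : Derivation ℂ (Poly n) (Poly n) :=
  ∑ c, a c • pderiv (Sum.inr c)

theorem derivX_apply (a : Pt n) (f : Poly n) :
    derivX a f = ∑ c, a c • pderiv (Sum.inl c) f := by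
  simp [derivX, derivation_sum_apply]

theorem derivY_apply (a : Pt n) (f : Poly n) :
    derivY a f = ∑ c, a c • pderiv (Sum.inr c) f := by
  simp [derivY, derivation_sum_apply]

theorem derivX_X_inl (a : Pt n) (c : Fin n ⊕ Fin n) : derivX a (X (Sum.inl c)) = C (a c) := by
  rw [derivX_apply, Finset.sum_eq_single c (fun d _ hd => by simp [pderiv_X, hd])
    (fun h => absurd (Finset.mem_univ c) h)]
  simp [smul_eq_C_mul]

theorem derivX_X_inr (a : Pt n) (c : Fin n ⊕ Fin n) : derivX a (X (Sum.inr c)) = 0 := by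
  rw [derivX_apply]
  exact Finset.sum_eq_zero fun d _ => by simp [pderiv_X]

theorem derivY_X_inr (a : Pt n) (c : Fin n ⊕ Fin n) : derivY a (X (Sum.inr c)) = C (a c) := by
  rw [derivY_apply, Finset.sum_eq_single c (fun d _ hd => by simp [pderiv_X, hd])
    (fun h => absurd (Finset.mem_univ c) h)]
  simp [smul_eq_C_mul]

theorem derivY_X_inl (a : Pt n) (c : Fin n ⊕ Fin n) : derivY a (X (Sum.inl c)) = 0 := by
  rw [derivY_apply]
  exact Finset.sum_eq_zero fun d _ => by simp [pderiv_X]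

theorem derivX_linX (a b : Pt n) : derivX a (linX b) = C (∑ c, a c * b c) := by
  rw [linX, map_sum, map_sum]
  refine Finset.sum_congr rfl fun c _ => ?_
  rw [Derivation.map_smul, derivX_X_inl, smul_eq_C_mul, ← map_mul, mul_comm]

theorem derivX_linY (a b : Pt n) : derivX a (linY b) = 0 := by
  simp [linY, derivX_X_inr]

theorem derivY_linX (a b : Pt n) : derivY a (linX b) = 0 := by
  simp [linX, derivY_X_inl]

theorem derivY_linY (a b : Pt n) : derivY a (linY b) = C (∑ c, a c * b c) := by
  rw [linY, map_sum, map_sum]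
  refine Finset.sum_congr rfl fun c _ => ?_
  rw [Derivation.map_smul, derivY_X_inr, smul_eq_C_mul, ← map_mul, mul_comm]

theorem derivX_mem_bideg (a : Pt n) {p q : ℕ} {f : Poly n} (hf : f ∈ bideg n (p + 1) q) :
    derivX a f ∈ bideg n p q := by
  rw [derivX_apply]
  exact Submodule.sum_mem _ fun c _ => Submodule.smul_mem _ _ (pderiv_inl_mem_bideg c hf)

theorem derivY_mem_bideg (a : Pt n) {p q : ℕ} {f : Poly n} (hf : f ∈ bideg n p (q + 1)) :
    derivY a f ∈ bideg n p q := by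
  rw [derivY_apply]
  exact Submodule.sum_mem _ fun c _ => Submodule.smul_mem _ _ (pderiv_inr_mem_bideg c hf)

theorem laplacian_linX_mul (a : Pt n) (f : Poly n) :
    laplacian n (linX a * f) = linX a * laplacian n f + (4 : ℂ) • derivY a f := by
  have h1 : ∀ c, pderiv (Sum.inr c) (linX a) = 0 := fun c => by simp [linX, pderiv_X]
  have h2 : ∀ c, pderiv (Sum.inl c) (linX a) = C (a c) := fun c => by
    rw [linX, map_sum, Finset.sum_eq_single c (fun d _ hd => by simp [pderiv_X, hd])
      (fun h => absurd (Finset.mem_univ c) h)]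
    simp [smul_eq_C_mul]
  rw [laplacian_eq_sum, laplacian_eq_sum, derivY_apply, mul_smul_comm, ← smul_add, Finset.mul_sum,
    ← Finset.sum_add_distrib]
  congr 1
  refine Finset.sum_congr rfl fun c _ => ?_
  rw [pderiv_mul, h1, zero_mul, zero_add, pderiv_mul, h2, smul_eq_C_mul, add_comm]

theorem laplacian_linY_mul (a : Pt n) (f : Poly n) :
    laplacian n (linY a * f) = linY a * laplacian n f + (4 : ℂ) • derivX a f := by
  have h1 : ∀ c, pderiv (Sum.inl c) (linY a) = 0 := fun c => by simp [linY, pderiv_X]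
  have h2 : ∀ c, pderiv (Sum.inr c) (linY a) = C (a c) := fun c => by
    rw [linY, map_sum, Finset.sum_eq_single c (fun d _ hd => by simp [pderiv_X, hd])
      (fun h => absurd (Finset.mem_univ c) h)]
    simp [smul_eq_C_mul]
  rw [laplacian_eq_sum, laplacian_eq_sum, derivX_apply, mul_smul_comm, ← smul_add, Finset.mul_sum,
    ← Finset.sum_add_distrib]
  congr 1
  refine Finset.sum_congr rfl fun c _ => ?_
  rw [pderiv_mul, h2, map_add, pderiv_C_mul, pderiv_mul, h1, zero_mul, zero_add, smul_eq_C_mul,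
    add_comm]

theorem sum_mul_rot_self (a : Pt n) : ∑ c, a c * rot a c = 0 := by
  rw [Fintype.sum_sum_type, ← Finset.sum_add_distrib]
  exact Finset.sum_eq_zero fun i _ => by simp only [rot, Sum.elim_inl, Sum.elim_inr]; ring

theorem sum_mul_rot_swap (a b : Pt n) : ∑ c, a c * rot b c = - ∑ c, b c * rot a c := by
  rw [Fintype.sum_sum_type, Fintype.sum_sum_type, ← Finset.sum_add_distrib,
    ← Finset.sum_add_distrib, ← Finset.sum_neg_distrib]
  exact Finset.sum_congr rfl fun i _ => by simp only [rot, Sum.elim_inl, Sum.elim_inr]; ring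

/-- Polynomials in linear forms that are isotropic for the quadratic form are harmonic. -/
theorem laplacian_weightPoly {a b : Pt n} (hab : ∑ c, a c * rot b c = 0) (i j q : ℕ) :
    laplacian n (weightPoly a b i j q) = 0 := by
  -- The space `K` is stable under multiplication by the four linear forms.
  let K : Submodule ℂ (Poly n) := LinearMap.ker (laplacian n) ⊓
    ((LinearMap.ker (derivY a).toLinearMap ⊓ LinearMap.ker (derivY b).toLinearMap) ⊓
    (LinearMap.ker (derivX (rot a)).toLinearMap ⊓ LinearMap.ker (derivX (rot b)).toLinearMap))
  have hK : ∀ f, f ∈ K ↔ laplacian n f = 0 ∧ (derivY a f = 0 ∧ derivY b f = 0) ∧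
      (derivX (rot a) f = 0 ∧ derivX (rot b) f = 0) := fun f => Iff.rfl
  have hba : ∑ c, b c * rot a c = 0 := by rw [sum_mul_rot_swap, hab, neg_zero]
  have hcomm : ∀ u v : Pt n, ∑ c, u c * v c = ∑ c, v c * u c := fun u v =>
    Finset.sum_congr rfl fun c _ => mul_comm _ _
  have ha : ∀ f ∈ K, linX a * f ∈ K := fun f hf => by
    obtain ⟨h1, ⟨h2, h3⟩, h4, h5⟩ := (hK f).1 hf
    simp [-Fintype.sum_sum_type, hK, laplacian_linX_mul, Derivation.leibniz, derivY_linX,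
      derivX_linX, h1, h2, h3, h4, h5, hcomm (rot a) a, hcomm (rot b) a, sum_mul_rot_self, hab]
  have hb : ∀ f ∈ K, linX b * f ∈ K := fun f hf => by
    obtain ⟨h1, ⟨h2, h3⟩, h4, h5⟩ := (hK f).1 hf
    simp [-Fintype.sum_sum_type, hK, laplacian_linX_mul, Derivation.leibniz, derivY_linX,
      derivX_linX, h1, h2, h3, h4, h5, hcomm (rot a) b, hcomm (rot b) b, sum_mul_rot_self, hba]
  have ha' : ∀ f ∈ K, linY (rot a) * f ∈ K := fun f hf => by
    obtain ⟨h1, ⟨h2, h3⟩, h4, h5⟩ := (hK f).1 hf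
    simp [-Fintype.sum_sum_type, hK, laplacian_linY_mul, Derivation.leibniz, derivY_linY,
      derivX_linY, h1, h2, h3, h4, h5, sum_mul_rot_self, hba]
  have hb' : ∀ f ∈ K, linY (rot b) * f ∈ K := fun f hf => by
    obtain ⟨h1, ⟨h2, h3⟩, h4, h5⟩ := (hK f).1 hf
    simp [-Fintype.sum_sum_type, hK, laplacian_linY_mul, Derivation.leibniz, derivY_linY,
      derivX_linY, h1, h2, h3, h4, h5, sum_mul_rot_self, hab]
  have hw : ∀ f ∈ K, wedge a b * f ∈ K := fun f hf => by
    rw [wedge, sub_mul, mul_assoc, mul_assoc]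
    exact K.sub_mem (hb _ (ha' _ hf)) (ha _ (hb' _ hf))
  have hpow : ∀ g : Poly n, (∀ f ∈ K, g * f ∈ K) → ∀ r, ∀ f ∈ K, g ^ r * f ∈ K := by
    intro g hg r
    induction r with
    | zero => intro f hf; simpa using hf
    | succ r ih => intro f hf; rw [pow_succ, mul_assoc]; exact ih _ (hg _ hf)
  have h1 : (1 : Poly n) ∈ K := by
    rw [hK]
    simp [laplacian_eq_sum]
  have h := hpow _ ha i _ (hpow _ ha' j _ (hpow _ hw q _ h1))
  rw [mul_one, ← mul_assoc] at h
  exact h.1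

theorem weightPoly_mem_harmBideg {a b : Pt n} (hab : ∑ c, a c * rot b c = 0) (i j q : ℕ) :
    weightPoly a b i j q ∈ harmBideg n (i + q) (j + q) :=
  ⟨weightPoly_mem_bideg a b i j q, laplacian_weightPoly hab i j q⟩

theorem weightPoly_mem_primitives {a b : Pt n} (hab : ∑ c, a c * rot b c = 0) (i q : ℕ) :
    weightPoly a b i 0 q ∈ primitives n (i + q) q := by
  refine ⟨?_, raiseOp_weightPoly_zero a b i q⟩
  have h := weightPoly_mem_harmBideg hab i 0 q
  rwa [zero_add] at h

theorem fischer_linX_mul (a : Pt n) (f g : Poly n) :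
    fischer (linX a * f) g = fischer f (derivX (star a) g) := by
  rw [linX, Finset.sum_mul, fischer_sum_left, derivX_apply, fischer_sum_right]
  refine Finset.sum_congr rfl fun c _ => ?_
  rw [smul_mul_assoc, fischer_smul_left, fischer_X_mul, fischer_smul_right]
  rfl

theorem fischer_linY_mul (a : Pt n) (f g : Poly n) :
    fischer (linY a * f) g = fischer f (derivY (star a) g) := by
  rw [linY, Finset.sum_mul, fischer_sum_left, derivY_apply, fischer_sum_right]
  refine Finset.sum_congr rfl fun c _ => ?_
  rw [smul_mul_assoc, fischer_smul_left, fischer_X_mul, fischer_smul_right]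
  rfl

theorem star_rot (a : Pt n) : star (rot a) = rot (star a) := by
  funext c
  rcases c with i | i <;> simp [rot]

/-- The differential operator adjoint to the multiplication by `wedge`. -/
noncomputable def wedgeOp (a b : Pt n) (f : Poly n) : Poly n :=
  derivX b (derivY (rot a) f) - derivX a (derivY (rot b) f)

theorem derivX_derivY_comm (a b : Pt n) (f : Poly n) :
    derivX a (derivY b f) = derivY b (derivX a f) := by
  have h : ⁅derivX a, derivY b⁆ = 0 := by
    refine derivation_ext fun v => ?_
    rw [Derivation.commutator_apply]
    rcases v with c | c <;> simp [derivX_X_inl, derivX_X_inr, derivY_X_inl, derivY_X_inr]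
  have h2 := congrArg (fun D => D f) h
  simpa [Derivation.commutator_apply, sub_eq_zero] using h2

theorem derivY_derivY_comm (a b : Pt n) (f : Poly n) :
    derivY a (derivY b f) = derivY b (derivY a f) := by
  have h : ⁅derivY a, derivY b⁆ = 0 := by
    refine derivation_ext fun v => ?_
    rw [Derivation.commutator_apply]
    rcases v with c | c <;> simp [derivY_X_inl, derivY_X_inr]
  have h2 := congrArg (fun D => D f) h
  simpa [Derivation.commutator_apply, sub_eq_zero] using h2

theorem derivX_raiseOp (a : Pt n) (f : Poly n) :
    derivX a (raiseOp n f) = raiseOp n (derivX a f) + derivY (rot a) f := by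
  have h : ⁅derivX a, raiseOp n⁆ = derivY (rot a) := by
    refine derivation_ext fun v => ?_
    rw [Derivation.commutator_apply]
    rcases v with c | (i | i) <;>
      simp [raiseOp_X_inl, raiseOp_X_inr_inl, raiseOp_X_inr_inr, derivX_X_inl, derivX_X_inr,
        derivY_X_inl, derivY_X_inr, rot]
  have h2 := congrArg (fun D => D f) h
  rw [Derivation.commutator_apply, sub_eq_iff_eq_add'] at h2
  exact h2

theorem derivY_raiseOp (a : Pt n) (f : Poly n) :
    derivY a (raiseOp n f) = raiseOp n (derivY a f) := by
  have h : ⁅derivY a, raiseOp n⁆ = 0 := by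
    refine derivation_ext fun v => ?_
    rw [Derivation.commutator_apply]
    rcases v with c | (i | i) <;>
      simp [raiseOp_X_inl, raiseOp_X_inr_inl, raiseOp_X_inr_inr, derivY_X_inl, derivY_X_inr]
  have h2 := congrArg (fun D => D f) h
  simpa [Derivation.commutator_apply, sub_eq_zero] using h2

theorem fischer_wedge_mul (a b : Pt n) (f g : Poly n) :
    fischer (wedge a b * f) g = fischer f (wedgeOp (star a) (star b) g) := by
  rw [wedge, sub_mul, fischer_sub_left, mul_assoc, mul_assoc, fischer_linX_mul, fischer_linY_mul,
    fischer_linX_mul, fischer_linY_mul, wedgeOp, fischer_sub_right, star_rot, star_rot,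
    derivX_derivY_comm, derivX_derivY_comm]

theorem raiseOp_wedgeOp (a b : Pt n) {f : Poly n} (hf : raiseOp n f = 0) :
    raiseOp n (wedgeOp a b f) = 0 := by
  have h : ∀ u v : Pt n, raiseOp n (derivX u (derivY v f)) = - derivY (rot u) (derivY v f) := by
    intro u v
    rw [eq_neg_iff_add_eq_zero, ← derivX_raiseOp, ← derivY_raiseOp, hf, map_zero, map_zero]
  rw [wedgeOp, map_sub, h, h, derivY_derivY_comm (rot a)]
  ring

theorem wedgeOp_mem_bideg (a b : Pt n) {p q : ℕ} {f : Poly n}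
    (hf : f ∈ bideg n (p + 1) (q + 1)) : wedgeOp a b f ∈ bideg n p q :=
  Submodule.sub_mem _ (derivX_mem_bideg _ (derivY_mem_bideg _ hf))
    (derivX_mem_bideg _ (derivY_mem_bideg _ hf))

theorem eval_derivX (a b : Pt n) {p q : ℕ} {f : Poly n} (hf : f ∈ bideg n p q) :
    eval (Sum.elim a b) (derivX a f) = p * eval (Sum.elim a b) f := by
  have h := congrArg (eval (Sum.elim a b)) (euler_inl hf)
  rw [smul_eval] at h
  rw [← h, derivX_apply]
  simp

theorem eval_derivY (a b : Pt n) {p q : ℕ} {f : Poly n} (hf : f ∈ bideg n p q) :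
    eval (Sum.elim a b) (derivY b f) = q * eval (Sum.elim a b) f := by
  have h := congrArg (eval (Sum.elim a b)) (euler_inr hf)
  rw [smul_eval] at h
  rw [← h, derivY_apply]
  simp

theorem eval_raiseOp (a b : Pt n) (f : Poly n) :
    eval (Sum.elim a b) (raiseOp n f) = eval (Sum.elim a b) (derivY (rot a) f) := by
  rw [raiseOp_apply, derivY_apply, Fintype.sum_sum_type, ← Finset.sum_add_distrib]
  simp [rot, sub_eq_add_neg]

/-- A form of Capelli's identity: on polynomials killed by `E`, the operator `wedgeOp a b` acts at
the point `(a, rot b)` by a nonzero scalar. -/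
theorem eval_wedgeOp (a b : Pt n) {p q : ℕ} {f : Poly n} (hf : f ∈ bideg n (p + 1) (q + 1))
    (h : raiseOp n f = 0) : eval (Sum.elim a (rot b)) (wedgeOp a b f) =
      - ((q + 1) * (p + 2)) * eval (Sum.elim a (rot b)) f := by
  have h1 : eval (Sum.elim a (rot b)) (derivX b (derivY (rot a) f)) =
      - (q + 1) * eval (Sum.elim a (rot b)) f := by
    have e := congrArg (eval (Sum.elim a (rot b))) (derivX_raiseOp b f)
    rw [h, map_zero, map_zero, map_add, eval_raiseOp, eval_derivY a (rot b) hf,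
      ← derivX_derivY_comm] at e
    push_cast at e
    linear_combination -e
  have h2 := eval_derivX a (rot b) (derivY_mem_bideg (rot b) hf)
  rw [eval_derivY a (rot b) hf] at h2
  rw [wedgeOp, map_sub, h1, h2]
  push_cast
  ring

theorem eval_eq_coeff_zero {f : Poly n} (hf : f ∈ bideg n 0 0)
    (x : (Fin n ⊕ Fin n) ⊕ (Fin n ⊕ Fin n) → ℂ) : eval x f = coeff 0 f := by
  have h : f = C (coeff 0 f) := by
    ext s
    rw [coeff_C]
    split_ifs with hs
    · rw [hs]
    · by_contra h0
      obtain ⟨h1, h2⟩ := mem_bideg_iff.1 hf s h0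
      rw [Finset.sum_eq_zero_iff] at h1 h2
      refine hs (Finsupp.ext fun v => ?_)
      rcases v with c | c
      · exact (h1 c (Finset.mem_univ c)).symm
      · exact (h2 c (Finset.mem_univ c)).symm
  conv_lhs => rw [h, eval_C]

/-- Pairing a polynomial killed by `E` with a product of linear forms is, up to a nonzero scalar,
evaluation at a point. -/
theorem fischer_weightPoly (a b : Pt n) (m q : ℕ) : ∃ c : ℂ, c ≠ 0 ∧
    ∀ f ∈ bideg n (m + q) q, raiseOp n f = 0 → fischer (weightPoly a b m 0 q) f =
      c * eval (Sum.elim (star a) (rot (star b))) f := by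
  induction q with
  | zero =>
    induction m with
    | zero =>
      refine ⟨1, one_ne_zero, fun f hf _ => ?_⟩
      rw [eval_eq_coeff_zero hf]
      simp [weightPoly, fischer_one_left]
    | succ m ih =>
      obtain ⟨c, hc, h⟩ := ih
      refine ⟨c * (m + 1 : ℕ), mul_ne_zero hc (Nat.cast_ne_zero.2 (Nat.succ_ne_zero m)),
        fun f hf _ => ?_⟩
      have e : weightPoly a b (m + 1) 0 0 = linX a * weightPoly a b m 0 0 := by
        simp only [weightPoly]
        ring
      rw [e, fischer_linX_mul, h _ (derivX_mem_bideg _ hf) (raiseOp_eq_zero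
        (derivX_mem_bideg _ hf)), eval_derivX _ _ hf]
      push_cast
      ring
  | succ q ih =>
    obtain ⟨c, hc, h⟩ := ih
    refine ⟨c * -((q + 1 : ℕ) * (m + q + 2 : ℕ)), mul_ne_zero hc (neg_ne_zero.2 (mul_ne_zero
      (Nat.cast_ne_zero.2 (Nat.succ_ne_zero q)) (Nat.cast_ne_zero.2 (Nat.succ_ne_zero _)))),
      fun f hf hE => ?_⟩
    replace hf : f ∈ bideg n (m + q + 1) (q + 1) := hf
    have e : weightPoly a b m 0 (q + 1) = wedge a b * weightPoly a b m 0 q := by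
      simp only [weightPoly]
      ring
    rw [e, fischer_wedge_mul, h _ (wedgeOp_mem_bideg _ _ hf) (raiseOp_wedgeOp _ _ hE),
      eval_wedgeOp _ _ hf hE]
    push_cast
    ring

/-! ### Quaternionic frames -/

theorem rot_add (a b : Pt n) : rot (a + b) = rot a + rot b := by
  funext c
  rcases c with i | i <;> simp [rot, add_comm]

theorem rot_smul (t : ℂ) (a : Pt n) : rot (t • a) = t • rot a := by
  funext c
  rcases c with i | i <;> simp [rot]

theorem rot_rot (a : Pt n) : rot (rot a) = -a := by
  funext c
  rcases c with i | i <;> simp [rot]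

theorem rot_dotProduct_rot (a b : Pt n) : rot a ⬝ᵥ rot b = a ⬝ᵥ b := by
  simp [dotProduct, rot, add_comm]

theorem dotProduct_rot_self (a : Pt n) : a ⬝ᵥ rot a = 0 := sum_mul_rot_self a

theorem dotProduct_rot_swap (a b : Pt n) : a ⬝ᵥ rot b = - (b ⬝ᵥ rot a) := sum_mul_rot_swap a b

theorem exists_smul_unit {a : Pt n} (ha : a ≠ 0) :
    ∃ (t : ℝ) (b : Pt n), 0 < t ∧ a = (t : ℂ) • b ∧ star b ⬝ᵥ b = 1 := by
  let s : ℝ := ∑ c, Complex.normSq (a c)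
  have hs : (s : ℂ) = star a ⬝ᵥ a := by
    simp only [s, Complex.ofReal_sum, dotProduct, Complex.normSq_eq_conj_mul_self]
    rfl
  have hs0 : 0 < s := by
    obtain ⟨c, hc⟩ := Function.ne_iff.1 ha
    exact Finset.sum_pos' (fun _ _ => Complex.normSq_nonneg _)
      ⟨c, Finset.mem_univ c, Complex.normSq_pos.2 hc⟩
  have ht := Real.sqrt_pos.2 hs0
  have ht0 : ((Real.sqrt s : ℝ) : ℂ) ≠ 0 := by exact_mod_cast ht.ne'
  refine ⟨Real.sqrt s, ((Real.sqrt s : ℝ) : ℂ)⁻¹ • a, ht, ?_, ?_⟩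
  · rw [smul_smul, mul_inv_cancel₀ ht0, one_smul]
  · rw [star_smul, smul_dotProduct, dotProduct_smul, ← hs, smul_eq_mul, smul_eq_mul, star_inv₀,
      Complex.star_def, Complex.conj_ofReal]
    have h2 : ((Real.sqrt s : ℝ) : ℂ) * ((Real.sqrt s : ℝ) : ℂ) = s := by
      exact_mod_cast Real.mul_self_sqrt hs0.le
    rw [← h2]
    field_simp

/-- The vectors `v 0, …, v (r - 1)` form a unitary frame that spans an isotropic subspace for the
symplectic form, that is, they are orthonormal over the quaternions. -/
def IsFrame (v : ℕ → Pt n) (r : ℕ) : Prop :=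
  ∀ i < r, ∀ j < r, star (v i) ⬝ᵥ v j = (if i = j then 1 else 0) ∧ v i ⬝ᵥ rot (v j) = 0

/-- A unit vector orthogonal to the quaternionic span of `r < n` vectors: the `2r` linear conditions
have a nonzero solution in dimension `2n`. -/
theorem IsFrame.exists_unit_orthogonal {v : ℕ → Pt n} {r : ℕ} (hr : r < n) :
    ∃ b : Pt n, star b ⬝ᵥ b = 1 ∧ ∀ i < r, star (v i) ⬝ᵥ b = 0 ∧ v i ⬝ᵥ rot b = 0 := by
  let A : Matrix (Fin r ⊕ Fin r) (Fin n ⊕ Fin n) ℂ :=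
    Sum.elim (fun i => star (v i)) (fun i => rot (v i))
  have hker : LinearMap.ker A.mulVecLin ≠ ⊥ := LinearMap.ker_ne_bot_of_finrank_lt (by simp; omega)
  obtain ⟨x, hx, hx0⟩ := Submodule.exists_mem_ne_zero_of_ne_bot hker
  obtain ⟨t, b, ht, rfl, hb⟩ := exists_smul_unit hx0
  have ht0 : (t : ℂ) ≠ 0 := by exact_mod_cast ht.ne'
  rw [LinearMap.mem_ker, map_smul, smul_eq_zero, or_iff_right ht0, Matrix.mulVecLin_apply] at hx
  refine ⟨b, hb, fun i hi => ⟨congrFun hx (Sum.inl ⟨i, hi⟩), ?_⟩⟩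
  have h2 : rot (v i) ⬝ᵥ b = 0 := congrFun hx (Sum.inr ⟨i, hi⟩)
  rw [← rot_dotProduct_rot, rot_rot, neg_dotProduct, neg_eq_zero] at h2
  exact h2

theorem IsFrame.extend {v : ℕ → Pt n} {r : ℕ} (hv : IsFrame v r) (hr : r < n) :
    ∃ b, IsFrame (Function.update v r b) (r + 1) := by
  obtain ⟨b, hb, h⟩ := IsFrame.exists_unit_orthogonal (v := v) hr
  refine ⟨b, fun i hi j hj => ?_⟩
  rcases Nat.lt_succ_iff_lt_or_eq.1 hi with hi | rfl <;>
    rcases Nat.lt_succ_iff_lt_or_eq.1 hj with hj | rfl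
  · rw [Function.update_of_ne hi.ne, Function.update_of_ne hj.ne]
    exact hv i hi j hj
  · rw [Function.update_of_ne hi.ne, Function.update_self, if_neg hi.ne]
    exact h i hi
  · rw [Function.update_of_ne hj.ne, Function.update_self, if_neg hj.ne']
    refine ⟨?_, ?_⟩
    · have h1 := congrArg star (h j hj).1
      rwa [← Matrix.star_dotProduct, star_zero] at h1
    · rw [dotProduct_rot_swap, (h j hj).2, neg_zero]
  · rw [Function.update_self, if_pos rfl]
    exact ⟨hb, dotProduct_rot_self b⟩

theorem IsFrame.exists_extension {v : ℕ → Pt n} {r : ℕ} (hv : IsFrame v r) {s : ℕ} (hrs : r ≤ s)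
    (hs : s ≤ n) : ∃ v', IsFrame v' s ∧ ∀ i < r, v' i = v i := by
  induction s, hrs using Nat.le_induction with
  | base => exact ⟨v, hv, fun _ _ => rfl⟩
  | succ s hrs ih =>
    obtain ⟨v', h1, h2⟩ := ih (by omega)
    obtain ⟨b, hb⟩ := h1.extend (by omega)
    refine ⟨_, hb, fun i hi => ?_⟩
    rw [Function.update_of_ne (by omega), h2 i hi]

theorem J_mulVec (a : Pt n) : (Matrix.J (Fin n) ℂ).mulVec a = - rot a := by
  rw [Matrix.J, Matrix.fromBlocks_mulVec]
  funext c
  rcases c with i | i <;> simp [rot, Matrix.neg_mulVec]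

/-- The matrix of `Sp(n)` whose complex conjugate sends the basis vectors `w₁, …, wₙ` to a given
quaternionic frame. -/
def frameMatrix (v : ℕ → Pt n) : Matrix (Fin n ⊕ Fin n) (Fin n ⊕ Fin n) ℂ :=
  fun d => Sum.elim (fun i => rot (v i) d) (fun i => star (v i) d)

theorem frameMatrix_mem_spGroup {v : ℕ → Pt n} (hv : IsFrame v n) : frameMatrix v ∈ spGroup n := by
  have h1 : ∀ i j : Fin n, star (v i) ⬝ᵥ v j = if i = j then 1 else 0 := fun i j => by
    rw [(hv i i.2 j j.2).1]
    simp [Fin.ext_iff]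
  have h1' : ∀ i j : Fin n, v i ⬝ᵥ star (v j) = if i = j then 1 else 0 := fun i j => by
    rw [dotProduct_comm, h1]
    simp [eq_comm]
  have h2 : ∀ i j : Fin n, v i ⬝ᵥ rot (v j) = 0 := fun i j => (hv i i.2 j j.2).2
  have h3 : ∀ i j : Fin n, star (v i) ⬝ᵥ rot (star (v j)) = 0 := fun i j => by
    rw [← star_rot, Matrix.star_dotProduct_star, dotProduct_comm, h2, star_zero]
  constructor
  · rw [SetLike.mem_coe, Matrix.mem_unitaryGroup_iff']
    ext c d
    have e : (star (frameMatrix v) * frameMatrix v) c d =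
      star (fun x => frameMatrix v x c) ⬝ᵥ (fun x => frameMatrix v x d) := rfl
    rw [e]
    rcases c with i | i <;> rcases d with j | j <;>
      simp only [frameMatrix, Sum.elim_inl, Sum.elim_inr]
    · change star (rot (v i)) ⬝ᵥ rot (v j) = _
      rw [star_rot, rot_dotProduct_rot, h1]
      simp [Matrix.one_apply]
    · change star (rot (v i)) ⬝ᵥ star (v j) = _
      rw [star_rot, dotProduct_comm, h3]
      simp
    · change star (star (v i)) ⬝ᵥ rot (v j) = _
      rw [star_star, h2]
      simp
    · change star (star (v i)) ⬝ᵥ star (v j) = _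
      rw [star_star, h1']
      simp [Matrix.one_apply]
  · rw [SetLike.mem_coe, SymplecticGroup.mem_iff', mul_assoc]
    ext c d
    have e : ((frameMatrix v).transpose * (Matrix.J (Fin n) ℂ * frameMatrix v)) c d =
      (fun x => frameMatrix v x c) ⬝ᵥ (Matrix.J (Fin n) ℂ).mulVec (fun x => frameMatrix v x d) :=
        rfl
    rw [e, J_mulVec, dotProduct_neg]
    rcases c with i | i <;> rcases d with j | j <;>
      simp only [frameMatrix, Sum.elim_inl, Sum.elim_inr]
    · change -(rot (v i) ⬝ᵥ rot (rot (v j))) = _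
      rw [rot_dotProduct_rot, h2]
      simp [Matrix.J]
    · change -(rot (v i) ⬝ᵥ rot (star (v j))) = _
      rw [rot_dotProduct_rot, h1']
      simp [Matrix.J, Matrix.one_apply]
    · change -(star (v i) ⬝ᵥ rot (rot (v j))) = _
      rw [rot_rot, dotProduct_neg, h1]
      simp [Matrix.J, Matrix.one_apply]
    · change -(star (v i) ⬝ᵥ rot (star (v j))) = _
      rw [h3]
      simp [Matrix.J]

theorem exists_spGroup_of_isFrame {v : ℕ → Pt n} {r : ℕ} (hv : IsFrame v r) (hr : r ≤ n) :
    ∃ u ∈ spGroup n, ∀ i : Fin n, (i : ℕ) < r →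
      (u.map star).mulVec (Pi.single (Sum.inr i) 1) = v i := by
  obtain ⟨v', h1, h2⟩ := hv.exists_extension hr le_rfl
  refine ⟨_, frameMatrix_mem_spGroup h1, fun i hi => ?_⟩
  funext d
  rw [Matrix.mulVec_single_one, ← h2 i hi]
  simp [frameMatrix]

/-! ### Vanishing on the isotropic quadric -/

theorem eval_smul_smul {p q : ℕ} {f : Poly n} (hf : f ∈ bideg n p q) (s t : ℂ) (x y : Pt n) :
    eval (Sum.elim (s • x) (t • y)) f = s ^ p * t ^ q * eval (Sum.elim x y) f := by
  rw [eval_eq', eval_eq', Finset.mul_sum]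
  refine Finset.sum_congr rfl fun d hd => ?_
  obtain ⟨h1, h2⟩ := mem_bideg_iff.1 hf d (mem_support_iff.1 hd)
  rw [Fintype.prod_sum_type (fun v => Sum.elim (s • x) (t • y) v ^ d v),
    Fintype.prod_sum_type (fun v => Sum.elim x y v ^ d v)]
  simp only [Sum.elim_inl, Sum.elim_inr, Pi.smul_apply, smul_eq_mul, mul_pow,
    Finset.prod_mul_distrib, Finset.prod_pow_eq_pow_sum, h1, h2]
  ring

theorem hasDerivAt_eval_add_smul (x y v : Pt n) (f : Poly n) (t : ℂ) :
    HasDerivAt (fun t : ℂ => eval (Sum.elim x (y + t • v)) f)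
      (eval (Sum.elim x (y + t • v)) (derivY v f)) t := by
  induction f using MvPolynomial.induction_on with
  | C c => simpa [derivY_apply] using hasDerivAt_const t c
  | add f g hf hg =>
    simp only [map_add]
    exact hf.add hg
  | mul_X f w hf =>
    have hX : HasDerivAt (fun t : ℂ => eval (Sum.elim x (y + t • v)) (X w : Poly n))
        (eval (Sum.elim x (y + t • v)) (derivY v (X w))) t := by
      rcases w with c | c
      · simpa [derivY_X_inl] using hasDerivAt_const t (x c)
      · simpa [derivY_X_inr] using ((hasDerivAt_id t).mul_const (v c)).const_add (y c)
    simp only [Derivation.leibniz, smul_eq_mul, map_add, map_mul]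
    exact (hf.mul hX).congr_deriv (by ring)

/-- A polynomial killed by `E` is invariant under the shears generated by `E`. -/
theorem eval_add_smul_rot {f : Poly n} (hf : raiseOp n f = 0) (x y : Pt n) (t : ℂ) :
    eval (Sum.elim x (y + t • rot x)) f = eval (Sum.elim x y) f := by
  have h : ∀ t, HasDerivAt (fun t : ℂ => eval (Sum.elim x (y + t • rot x)) f) 0 t := fun t => by
    have h1 := hasDerivAt_eval_add_smul x y (rot x) f t
    rwa [← eval_raiseOp, hf, map_zero] at h1
  have h2 := is_const_of_deriv_eq_zero (fun t => (h t).differentiableAt) (fun t => (h t).deriv) t 0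
  simpa using h2

/-- The frame of length two given by the vectors `a` and `b`. -/
def frameTwo (a b : Pt n) : ℕ → Pt n := fun i => if i = 0 then a else b

theorem isFrame_frameTwo {a b : Pt n} (ha : star a ⬝ᵥ a = 1) (hb : star b ⬝ᵥ b = 1)
    (hab : star a ⬝ᵥ b = 0) (hr : a ⬝ᵥ rot b = 0) : IsFrame (frameTwo a b) 2 := by
  have hba : star b ⬝ᵥ a = 0 := by rw [Matrix.star_dotProduct, hab, star_zero]
  have hr' : b ⬝ᵥ rot a = 0 := by rw [dotProduct_rot_swap, hr, neg_zero]
  intro i hi j hj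
  interval_cases i <;> interval_cases j <;>
    simp [frameTwo, ha, hb, hab, hr, hba, hr', dotProduct_rot_self]

/-- The shear `y ↦ y + t • rot x`, which does not change the values of `f`, moves an isotropic pair
`(x, y)` to a pair of the form `(s • a, t • rot b)` with a quaternionic frame `a`, `b`. -/
theorem exists_frameTwo_eval {f : Poly n} (hn : 2 ≤ n) (hE : raiseOp n f = 0) {x y : Pt n}
    (hx : x ≠ 0) (hxy : x ⬝ᵥ y = 0) : ∃ (a b : Pt n) (s t : ℂ), IsFrame (frameTwo a b) 2 ∧
      eval (Sum.elim x y) f = eval (Sum.elim (s • a) (t • rot b)) f := by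
  obtain ⟨s, a, hs, rfl, ha⟩ := exists_smul_unit hx
  have hs0 : (s : ℂ) ≠ 0 := by exact_mod_cast hs.ne'
  rw [smul_dotProduct, smul_eq_mul, mul_eq_zero, or_iff_right hs0] at hxy
  -- The component of `-rot y` orthogonal to `a`.
  let μ : ℂ := star a ⬝ᵥ rot y
  let b' : Pt n := - rot y + μ • a
  have h1 : star a ⬝ᵥ b' = 0 := by
    simp only [b', dotProduct_add, dotProduct_neg, dotProduct_smul, ha, smul_eq_mul, mul_one, μ]
    ring
  have h2 : rot b' = y + μ • rot a := by
    simp only [b', rot_add, rot_smul, ← neg_one_smul ℂ (rot y), rot_rot]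
    simp
  have h3 : a ⬝ᵥ rot b' = 0 := by
    rw [h2, dotProduct_add, dotProduct_smul, hxy, dotProduct_rot_self, smul_zero, add_zero]
  have h4 : eval (Sum.elim ((s : ℂ) • a) y) f = eval (Sum.elim ((s : ℂ) • a) (rot b')) f := by
    have h5 := eval_add_smul_rot hE ((s : ℂ) • a) y (μ * (s : ℂ)⁻¹)
    rw [rot_smul, smul_smul, mul_assoc, inv_mul_cancel₀ hs0, mul_one, ← h2] at h5
    exact h5.symm
  obtain ⟨b, t, hb, h5⟩ : ∃ (b : Pt n) (t : ℂ), IsFrame (frameTwo a b) 2 ∧ b' = t • b := by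
    by_cases hb0 : b' = 0
    · obtain ⟨b, hb, h⟩ := IsFrame.exists_unit_orthogonal (n := n) (v := fun _ => a) (r := 1)
        (by omega)
      have h := h 0 one_pos
      exact ⟨b, 0, isFrame_frameTwo ha hb h.1 h.2, by rw [hb0, zero_smul]⟩
    · obtain ⟨t, b, ht, hb', hb⟩ := exists_smul_unit hb0
      have ht0 : (t : ℂ) ≠ 0 := by exact_mod_cast ht.ne'
      rw [hb', dotProduct_smul, smul_eq_mul, mul_eq_zero, or_iff_right ht0] at h1
      rw [hb', rot_smul, dotProduct_smul, smul_eq_mul, mul_eq_zero, or_iff_right ht0] at h3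
      exact ⟨b, t, isFrame_frameTwo ha hb h1 h3, hb'⟩
  exact ⟨a, b, s, t, hb, by rw [h4, h5, rot_smul]⟩

/-- A bihomogeneous polynomial killed by `E` that vanishes at the points given by quaternionic
frames vanishes on the whole quadric. -/
theorem eval_eq_zero_of_isotropic (hn : 2 ≤ n) {p q : ℕ} {f : Poly n} (hf : f ∈ bideg n p q)
    (hE : raiseOp n f = 0)
    (h : ∀ a b : Pt n, IsFrame (frameTwo a b) 2 → eval (Sum.elim a (rot b)) f = 0)
    {x y : Pt n} (hxy : x ⬝ᵥ y = 0) : eval (Sum.elim x y) f = 0 := by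
  have key : ∀ {x y : Pt n}, x ≠ 0 → x ⬝ᵥ y = 0 → eval (Sum.elim x y) f = 0 := by
    intro x y hx hxy
    obtain ⟨a, b, s, t, hab, h1⟩ := exists_frameTwo_eval hn hE hx hxy
    rw [h1, eval_smul_smul hf, h a b hab, mul_zero]
  by_cases hx : x = 0
  · -- By homogeneity, the point `(0, y)` is reached from `(x', y)` with `x' ≠ 0`.
    obtain ⟨x', hx', hxy'⟩ : ∃ x' : Pt n, x' ≠ 0 ∧ x' ⬝ᵥ y = 0 := by
      by_cases hy : y = 0
      · refine ⟨Pi.single (Sum.inl ⟨0, by omega⟩) 1, ?_, by rw [hy, dotProduct_zero]⟩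
        simp
      · refine ⟨rot y, fun h0 => hy ?_, by rw [dotProduct_comm, dotProduct_rot_self]⟩
        have h1 := rot_rot y
        rw [h0, ← zero_smul ℂ (0 : Pt n), rot_smul, zero_smul] at h1
        exact neg_eq_zero.1 h1.symm
    have h1 := eval_smul_smul hf 0 1 x' y
    rw [zero_smul, one_smul, key hx' hxy', mul_zero] at h1
    rw [hx, h1]
  · exact key hx hxy

theorem irreducible_quad (hn : 0 < n) : Irreducible (quad n) := by
  have h := irreducible_sumSMulXSMulY (R := ℂ)
    (Finsupp.equivFunOnFinite.symm (fun _ : Fin n ⊕ Fin n => (1 : ℂ)))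
    ⟨Sum.inl ⟨0, hn⟩, by simp, Sum.inr ⟨0, hn⟩, by simp, by simp⟩
    (fun r hr => isUnit_of_dvd_one (by simpa using hr (Sum.inl ⟨0, hn⟩)))
  have e : sumSMulXSMulY (Finsupp.equivFunOnFinite.symm (fun _ : Fin n ⊕ Fin n => (1 : ℂ))) =
      quad n := by
    rw [sumSMulXSMulY, Finsupp.linearCombination_apply, Finsupp.sum_fintype _ _ (by simp), quad]
    simp
  rwa [e] at h

/-- By the Nullstellensatz, since `quad` is prime. -/
theorem quad_dvd_of_eval_eq_zero (hn : 0 < n) {f : Poly n}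
    (h : ∀ x y : Pt n, x ⬝ᵥ y = 0 → eval (Sum.elim x y) f = 0) : quad n ∣ f := by
  have hp : (Ideal.span {quad n}).IsPrime :=
    (Ideal.span_singleton_prime (quad_ne_zero hn)).2 (irreducible_quad hn).prime
  rw [← Ideal.mem_span_singleton, ← IsPrime.vanishingIdeal_zeroLocus (K := ℂ) (Ideal.span {quad n}),
    mem_vanishingIdeal_iff]
  intro u hu
  have h1 := (mem_zeroLocus_iff.1 hu) (quad n) (Ideal.mem_span_singleton_self _)
  have h2 : u = Sum.elim (fun c => u (Sum.inl c)) (fun c => u (Sum.inr c)) := by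
    funext v
    rcases v with c | c <;> rfl
  have h3 := h (fun c => u (Sum.inl c)) (fun c => u (Sum.inr c)) (by
    simpa [quad, dotProduct, -Fintype.sum_sum_type] using h1)
  rw [← h2] at h3
  exact h3

/-- A primitive harmonic polynomial that is orthogonal to the products of linear forms attached to
quaternionic frames vanishes: it vanishes on the quadric `quad = 0`, so it is divisible by `quad`,
and multiples of `quad` are orthogonal to harmonic polynomials. -/
theorem eq_zero_of_fischer_weightPoly (hn : 2 ≤ n) {m q : ℕ} {f : Poly n}
    (hf : f ∈ primitives n (m + q) q)
    (h : ∀ a b : Pt n, IsFrame (frameTwo a b) 2 → fischer (weightPoly a b m 0 q) f = 0) :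
    f = 0 := by
  obtain ⟨⟨hb, hl⟩, hE⟩ := mem_primitives.1 hf
  obtain ⟨g, rfl⟩ : quad n ∣ f := by
    refine quad_dvd_of_eval_eq_zero (by omega) fun x y hxy =>
      eval_eq_zero_of_isotropic hn hb hE (fun a b hab => ?_) hxy
    obtain ⟨c, hc, h1⟩ := fischer_weightPoly (star a) (star b) m q
    have hab' : IsFrame (frameTwo (star a) (star b)) 2 := by
      have h0 := (hab 0 two_pos 0 two_pos).1
      have h1 := (hab 1 one_lt_two 1 one_lt_two).1
      have h2 := (hab 1 one_lt_two 0 two_pos).1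
      have h3 := (hab 0 two_pos 1 one_lt_two).2
      simp only [frameTwo, if_true, one_ne_zero, if_false] at h0 h1 h2 h3
      refine isFrame_frameTwo ?_ ?_ ?_ ?_
      · rw [star_star, dotProduct_comm, h0]
      · rw [star_star, dotProduct_comm, h1]
      · rw [star_star, dotProduct_comm, h2]
      · rw [← star_rot, Matrix.star_dotProduct_star, dotProduct_comm, h3, star_zero]
    have h2 := h _ _ hab'
    rw [h1 _ hb hE, star_star, star_star] at h2
    exact (mul_eq_zero.1 h2).resolve_left hc
  have h1 := fischer_laplacian_right (quad n * g) g
  rw [hl, fischer_zero_right] at h1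
  exact eq_zero_of_fischer_self (by
    rw [(mul_eq_zero.1 h1.symm).resolve_left (by norm_num), Complex.zero_re])

/-! ### The action of `Sp(n)` -/

theorem spGroup_inv {u : Matrix (Fin n ⊕ Fin n) (Fin n ⊕ Fin n) ℂ} (hu : u ∈ spGroup n) :
    u⁻¹ = star u :=
  Matrix.inv_eq_left_inv (Matrix.mem_unitaryGroup_iff'.1 hu.1)

theorem spGroup_mulVec_rot {u : Matrix (Fin n ⊕ Fin n) (Fin n ⊕ Fin n) ℂ} (hu : u ∈ spGroup n)
    (a : Pt n) : u.mulVec (rot a) = rot ((u.map star).mulVec a) := by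
  have h1 : u * Matrix.J (Fin n) ℂ * u.transpose = Matrix.J (Fin n) ℂ :=
    SymplecticGroup.mem_iff.1 hu.2
  have h2 : u.transpose * u.map star = 1 := by
    have h3 := congrArg Matrix.transpose (Matrix.mem_unitaryGroup_iff'.1 hu.1)
    rw [Matrix.transpose_mul, Matrix.transpose_one, Matrix.star_eq_conjTranspose] at h3
    exact h3
  have h3 : u * Matrix.J (Fin n) ℂ = Matrix.J (Fin n) ℂ * u.map star := by
    rw [← h1, mul_assoc (u * _), h2, mul_one, h1]
  have h4 := congrArg (fun A => A.mulVec a) h3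
  simp only [← Matrix.mulVec_mulVec, J_mulVec, Matrix.mulVec_neg] at h4
  exact neg_injective h4

theorem polyFun_mul (f g : Poly n) : polyFun n (f * g) = polyFun n f * polyFun n g := by
  funext x
  simp [polyFun]

theorem polyFun_pow (f : Poly n) (r : ℕ) : polyFun n (f ^ r) = polyFun n f ^ r := by
  funext x
  simp [polyFun]

theorem polyFun_linX (a x : Pt n) : polyFun n (linX a) x = a ⬝ᵥ x := by
  simp [polyFun, linX, dotProduct]

theorem polyFun_linY (a x : Pt n) : polyFun n (linY a) x = a ⬝ᵥ star x := by
  simp [polyFun, linY, dotProduct]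

theorem polyFun_weightPoly (a b : Pt n) (i j q : ℕ) (x : Pt n) :
    polyFun n (weightPoly a b i j q) x = (a ⬝ᵥ x) ^ i * (rot a ⬝ᵥ star x) ^ j *
      ((b ⬝ᵥ x) * (rot a ⬝ᵥ star x) - (a ⬝ᵥ x) * (rot b ⬝ᵥ star x)) ^ q := by
  simp only [weightPoly, wedge, polyFun_mul, polyFun_pow, map_sub, Pi.mul_apply, Pi.pow_apply,
    Pi.sub_apply, polyFun_linX, polyFun_linY]

theorem leftAct_weightPoly {u : Matrix (Fin n ⊕ Fin n) (Fin n ⊕ Fin n) ℂ} (hu : u ∈ spGroup n)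
    (a b : Pt n) (i j q : ℕ) : leftAct u (polyFun n (weightPoly a b i j q)) =
      polyFun n (weightPoly ((u.map star).mulVec a) ((u.map star).mulVec b) i j q) := by
  have h1 : ∀ c x : Pt n, c ⬝ᵥ (star u).mulVec x = (u.map star).mulVec c ⬝ᵥ x := fun c x => by
    rw [Matrix.dotProduct_mulVec, ← Matrix.mulVec_transpose]
    rfl
  have h2 : ∀ c x : Pt n, rot c ⬝ᵥ star ((star u).mulVec x) =
      rot ((u.map star).mulVec c) ⬝ᵥ star x := fun c x => by
    rw [← spGroup_mulVec_rot hu, Matrix.star_mulVec, Matrix.star_eq_conjTranspose,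
      Matrix.conjTranspose_conjTranspose, dotProduct_comm, ← Matrix.dotProduct_mulVec,
      dotProduct_comm]
  funext x
  rw [leftAct, spGroup_inv hu, polyFun_weightPoly, polyFun_weightPoly, h1, h1, h2, h2]

theorem hwPoly_eq_polyFun (hn : 2 ≤ n) (γ α β : ℕ) : hwPoly n hn γ α β =
    polyFun n (weightPoly (Pi.single (Sum.inr ⟨0, by omega⟩) 1)
      (Pi.single (Sum.inr ⟨1, by omega⟩) 1) (α - γ) (β - γ) γ) := by
  have h : ∀ (i : Fin n) (x : Pt n), rot (Pi.single (Sum.inr i) (1 : ℂ)) ⬝ᵥ x = x (Sum.inl i) := by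
    intro i x
    have e : rot (Pi.single (Sum.inr i) (1 : ℂ)) = Pi.single (Sum.inl i) 1 := by
      funext c
      rcases c with j | j <;> simp [rot, Pi.single_apply]
    rw [e, single_one_dotProduct]
  funext x
  rw [polyFun_weightPoly, h, h, single_one_dotProduct, single_one_dotProduct]
  rfl

/-- A polynomial in the coordinates and their conjugates is determined by its function. -/
theorem polyFun_injective (n : ℕ) : Function.Injective (polyFun n) := by
  rw [← LinearMap.ker_eq_bot, LinearMap.ker_eq_bot']
  intro f hf
  -- In the real and imaginary parts `s`, `t` of the coordinates the polynomial is `g (s, t)`.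
  let g : Poly n := aeval (Sum.elim (fun c => X (Sum.inl c) + C Complex.I * X (Sum.inr c))
    (fun c => X (Sum.inl c) - C Complex.I * X (Sum.inr c))) f
  have hg : ∀ v : (Fin n ⊕ Fin n) ⊕ (Fin n ⊕ Fin n) → ℂ, eval v g =
      eval (Sum.elim (fun c => v (Sum.inl c) + Complex.I * v (Sum.inr c))
        (fun c => v (Sum.inl c) - Complex.I * v (Sum.inr c))) f := by
    intro v
    rw [← coe_aeval_eq_eval, ← coe_aeval_eq_eval]
    simp only [g, RingHom.coe_coe]
    rw [← AlgHom.comp_apply, comp_aeval]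
    congr 2
    funext w
    rcases w with c | c <;> simp
  have hg0 : g = 0 := by
    refine funext_set (fun _ => Set.range ((↑) : ℝ → ℂ))
      (fun _ => Set.infinite_range_of_injective Complex.ofReal_injective) fun v hv => ?_
    have hv' : ∀ w, ∃ r : ℝ, (r : ℂ) = v w := fun w => hv w (Set.mem_univ w)
    choose r hr using hv'
    rw [hg, map_zero]
    have h1 := congrFun hf (fun c => v (Sum.inl c) + Complex.I * v (Sum.inr c))
    have h2 : (fun c => conj (v (Sum.inl c) + Complex.I * v (Sum.inr c))) =
        fun c => v (Sum.inl c) - Complex.I * v (Sum.inr c) := by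
      funext c
      rw [← hr, ← hr]
      simp [sub_eq_add_neg]
    have h3 : eval (Sum.elim (fun c => v (Sum.inl c) + Complex.I * v (Sum.inr c))
        (fun c => conj (v (Sum.inl c) + Complex.I * v (Sum.inr c)))) f = 0 := h1
    rwa [h2] at h3
  refine MvPolynomial.funext fun v => ?_
  have h1 := hg (Sum.elim (fun c => (v (Sum.inl c) + v (Sum.inr c)) / 2)
    (fun c => (v (Sum.inl c) - v (Sum.inr c)) / (2 * Complex.I)))
  rw [hg0, map_zero] at h1
  rw [map_zero, h1]
  congr 2
  funext w
  rcases w with c | c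
  · simp only [Sum.elim_inl, Sum.elim_inr]
    field_simp
    ring
  · simp only [Sum.elim_inl, Sum.elim_inr]
    field_simp
    ring

theorem spGroup_dotProduct_rot {u : Matrix (Fin n ⊕ Fin n) (Fin n ⊕ Fin n) ℂ}
    (hu : u ∈ spGroup n) (a b : Pt n) :
    (u.map star).mulVec a ⬝ᵥ rot ((u.map star).mulVec b) = a ⬝ᵥ rot b := by
  have h3 := congrArg Matrix.transpose (Matrix.mem_unitaryGroup_iff'.1 hu.1)
  rw [Matrix.transpose_mul, Matrix.transpose_one, Matrix.star_eq_conjTranspose] at h3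
  have h4 : u.transpose * u.map star = 1 := h3
  rw [← spGroup_mulVec_rot hu, Matrix.dotProduct_mulVec, ← Matrix.mulVec_transpose,
    Matrix.mulVec_mulVec, h4, Matrix.one_mulVec]

/-- The left action as a linear map. -/
noncomputable def leftActLin (u : Matrix (Fin n ⊕ Fin n) (Fin n ⊕ Fin n) ℂ) :
    (Pt n → ℂ) →ₗ[ℂ] (Pt n → ℂ) :=
  LinearMap.funLeft ℂ ℂ fun x => u⁻¹.mulVec x

theorem leftActLin_apply (u : Matrix (Fin n ⊕ Fin n) (Fin n ⊕ Fin n) ℂ) (f : Pt n → ℂ) :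
    leftActLin u f = leftAct u f := rfl

theorem rmul_eq (M : Matrix (Fin 2) (Fin 2) ℂ) (x : Pt n) :
    rmul M x = M 0 0 • x - M 1 0 • rot (star x) := by
  funext c
  rcases c with i | i <;> simp [rmul, rot]

/-- The left action of `Sp(n)` commutes with the right action of `Sp(1)`. -/
theorem leftAct_rightRep {u : Matrix (Fin n ⊕ Fin n) (Fin n ⊕ Fin n) ℂ} (hu : u ∈ spGroup n)
    (q : Sp1) (f : Pt n → ℂ) : leftAct u (rightRep n q f) = rightRep n q (leftAct u f) := by
  have h1 : ∀ y : Pt n, (star u).mulVec (rot y) = rot (u.transpose.mulVec y) := by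
    intro y
    have h2 := spGroup_mulVec_rot hu (u.transpose.mulVec y)
    have h3 : u.map star * u.transpose = 1 := by
      have h3 := congrArg Matrix.transpose (Matrix.mem_unitaryGroup_iff.1 hu.1)
      rw [Matrix.transpose_mul, Matrix.transpose_one, Matrix.star_eq_conjTranspose] at h3
      exact h3
    rw [Matrix.mulVec_mulVec, h3, Matrix.one_mulVec] at h2
    rw [← h2, Matrix.mulVec_mulVec, Matrix.mem_unitaryGroup_iff'.1 hu.1, Matrix.one_mulVec]
  funext x
  rw [rightRep_apply, leftAct, leftAct, rightRep_apply, spGroup_inv hu, rmul_eq, rmul_eq,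
    Matrix.mulVec_sub, Matrix.mulVec_smul, Matrix.mulVec_smul, h1, Matrix.star_mulVec,
    Matrix.star_eq_conjTranspose, Matrix.conjTranspose_conjTranspose, Matrix.mulVec_transpose]

/-! ### The spaces generated by the highest weight vectors -/

/-- The primitive harmonic polynomials are spanned by the products attached to frames. -/
theorem span_weightPoly (hn : 2 ≤ n) (m q : ℕ) :
    Submodule.span ℂ {f | ∃ a b : Pt n, IsFrame (frameTwo a b) 2 ∧ f = weightPoly a b m 0 q} =
      primitives n (m + q) q := by
  have hle : Submodule.span ℂ
      {f | ∃ a b : Pt n, IsFrame (frameTwo a b) 2 ∧ f = weightPoly a b m 0 q} ≤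
      primitives n (m + q) q := by
    rw [Submodule.span_le]
    rintro _ ⟨a, b, hab, rfl⟩
    exact weightPoly_mem_primitives (hab 0 two_pos 1 one_lt_two).2 m q
  have := Submodule.finiteDimensional_of_le hle
  exact eq_of_forall_fischer_eq_zero hle fun f hf h => eq_zero_of_fischer_weightPoly hn hf
    fun a b hab => h _ (Submodule.subset_span ⟨a, b, hab, rfl⟩)

/-- The first vector of the standard frame, along `w₁`. -/
def baseOne (hn : 2 ≤ n) : Pt n := Pi.single (Sum.inr ⟨0, by omega⟩) 1

/-- The second vector of the standard frame, along `w₂`. -/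
def baseTwo (hn : 2 ≤ n) : Pt n := Pi.single (Sum.inr ⟨1, by omega⟩) 1

theorem baseOne_dotProduct_rot_baseTwo (hn : 2 ≤ n) : baseOne hn ⬝ᵥ rot (baseTwo hn) = 0 := by
  rw [baseOne, single_one_dotProduct]
  simp [rot, baseTwo]

/-- The `Sp(n)`-invariant space generated by the highest weight vector consists of the functions of
all primitive harmonic polynomials of its bidegree. -/
theorem spV_eq (hn : 2 ≤ n) {k γ : ℕ} (hγ : γ ≤ k / 2) :
    spV n hn γ (k - γ) γ = (primitives n (k - γ) γ).map (polyFun n) := by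
  have e1 : k - γ = (k - γ - γ) + γ := by omega
  have h0 : hwPoly n hn γ (k - γ) γ =
      polyFun n (weightPoly (baseOne hn) (baseTwo hn) (k - γ - γ) 0 γ) := by
    rw [hwPoly_eq_polyFun, Nat.sub_self]
    rfl
  refine le_antisymm ?_ ?_
  · rw [spV, Submodule.span_le]
    rintro _ ⟨u, hu, rfl⟩
    rw [h0, leftAct_weightPoly hu]
    refine ⟨_, ?_, rfl⟩
    have h1 := weightPoly_mem_primitives (n := n)
      ((spGroup_dotProduct_rot hu _ _).trans (baseOne_dotProduct_rot_baseTwo hn)) (k - γ - γ) γ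
    rwa [← e1] at h1
  · have h2 := span_weightPoly hn (k - γ - γ) γ
    rw [← e1] at h2
    rw [← h2, Submodule.map_span, Submodule.span_le]
    rintro _ ⟨_, ⟨a, b, hab, rfl⟩, rfl⟩
    obtain ⟨u, hu, h3⟩ := exists_spGroup_of_isFrame hab hn
    refine Submodule.subset_span ⟨u, hu, ?_⟩
    have h4 : (u.map star).mulVec (baseOne hn) = a := h3 ⟨0, by omega⟩ two_pos
    have h5 : (u.map star).mulVec (baseTwo hn) = b := h3 ⟨1, by omega⟩ one_lt_two
    rw [h0, leftAct_weightPoly hu, h4, h5]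

/-- The multiplicity is the dimension of a space of primitive harmonic polynomials. -/
theorem spDim_eq (hn : 2 ≤ n) {k γ : ℕ} (hγ : γ ≤ k / 2) :
    spDim n hn k γ = Module.finrank ℂ (primitives n (k - γ) γ) := by
  rw [spDim, spV_eq hn hγ]
  exact (Submodule.equivMapOfInjective _ (polyFun_injective n) _).finrank_eq.symm

/-- There are elements `u` of `Sp(n)` whose translates of the highest weight vector form a basis of
the primitive harmonic polynomials. -/
theorem exists_spGroup_basis (hn : 2 ≤ n) {k γ : ℕ} (hγ : γ ≤ k / 2) :
    ∃ u : Fin (spDim n hn k γ) → Matrix (Fin n ⊕ Fin n) (Fin n ⊕ Fin n) ℂ,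
      (∀ j, u j ∈ spGroup n) ∧
      LinearIndependent ℂ (fun j => weightPoly (((u j).map star).mulVec (baseOne hn))
        (((u j).map star).mulVec (baseTwo hn)) (k - γ - γ) 0 γ) ∧
      primitives n (k - γ) γ = Submodule.span ℂ (Set.range fun j =>
        weightPoly (((u j).map star).mulVec (baseOne hn))
          (((u j).map star).mulVec (baseTwo hn)) (k - γ - γ) 0 γ) := by
  have e1 : k - γ = (k - γ - γ) + γ := by omega
  have h2 := span_weightPoly hn (k - γ - γ) γ
  rw [← e1] at h2
  obtain ⟨B, hB, hBs, hBi⟩ := exists_linearIndependent ℂ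
    {f | ∃ a b : Pt n, IsFrame (frameTwo a b) 2 ∧ f = weightPoly a b (k - γ - γ) 0 γ}
  rw [h2] at hBs
  have hr : Module.finrank ℂ (Submodule.span ℂ (Set.range ((↑) : B → Poly n))) =
      spDim n hn k γ := by
    rw [Subtype.range_coe, hBs, spDim_eq hn hγ]
  have : FiniteDimensional ℂ (Submodule.span ℂ (Set.range ((↑) : B → Poly n))) := by
    rw [Subtype.range_coe, hBs]
    infer_instance
  let e : B ≃ Fin (spDim n hn k γ) :=
    (Module.Basis.span hBi).indexEquiv (Module.finBasisOfFinrankEq ℂ _ hr)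
  have h3 : ∀ j, ∃ u ∈ spGroup n, weightPoly ((u.map star).mulVec (baseOne hn))
      ((u.map star).mulVec (baseTwo hn)) (k - γ - γ) 0 γ = (e.symm j : Poly n) := by
    intro j
    obtain ⟨a, b, hab, h⟩ := hB (e.symm j).2
    obtain ⟨u, hu, h3⟩ := exists_spGroup_of_isFrame hab hn
    have h4 : (u.map star).mulVec (baseOne hn) = a := h3 ⟨0, by omega⟩ two_pos
    have h5 : (u.map star).mulVec (baseTwo hn) = b := h3 ⟨1, by omega⟩ one_lt_two
    exact ⟨u, hu, by rw [h4, h5, ← h]⟩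
  choose u hu h using h3
  refine ⟨u, hu, ?_, ?_⟩
  · simp only [h]
    exact hBi.comp _ e.symm.injective
  · simp only [h]
    rw [← hBs]
    congr 1
    have h6 := (e.symm.surjective.range_comp ((↑) : B → Poly n)).trans Subtype.range_coe
    exact h6.symm

/-! ### Decomposition of the harmonic polynomials -/

/-- Polynomials with distinct degrees in the conjugate coordinates are linearly independent. -/
theorem eq_zero_of_sum_bideg {κ : Type*} {T : Finset κ} {B : κ → Poly n} {d : κ → ℕ}
    (hd : Set.InjOn d T) (hB : ∀ i ∈ T, ∃ p, B i ∈ bideg n p (d i)) (h : ∑ i ∈ T, B i = 0)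
    {i : κ} (hi : i ∈ T) : B i = 0 := by
  ext s
  by_contra hs
  rw [coeff_zero] at hs
  obtain ⟨p, hp⟩ := hB i hi
  have h1 := (mem_bideg_iff.1 hp s hs).2
  have h2 := congrArg (coeff s) h
  rw [coeff_sum, coeff_zero, Finset.sum_eq_single_of_mem i hi fun j hj hji => ?_] at h2
  · exact hs h2
  · by_contra hj0
    obtain ⟨p', hp'⟩ := hB j hj
    exact hji (hd hj hi ((mem_bideg_iff.1 hp' s hj0).2.symm.trans h1))

/-- The harmonic polynomials are spanned by the primitive ones and the image of the lowering
operator, because the orthogonal complement of that image is the kernel of `E`. -/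
theorem harmBideg_succ (p q : ℕ) : primitives n p (q + 1) ⊔
    (harmBideg n (p + 1) q).map (lowerOp n).toLinearMap = harmBideg n p (q + 1) := by
  refine eq_of_forall_fischer_eq_zero (sup_le inf_le_left ?_) fun f hf h => ?_
  · rintro _ ⟨f, hf, rfl⟩
    exact lowerOp_mem_harmBideg hf
  · have h1 : fischer (lowerOp n (raiseOp n f)) f = 0 :=
      h _ (Submodule.mem_sup_right ⟨_, raiseOp_mem_harmBideg hf, rfl⟩)
    rw [fischer_lowerOp_left] at h1
    have h2 : raiseOp n f = 0 := eq_zero_of_fischer_self (by rw [h1, Complex.zero_re])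
    have h3 : fischer f f = 0 := h _ (Submodule.mem_sup_left ⟨hf, h2⟩)
    exact eq_zero_of_fischer_self (by rw [h3, Complex.zero_re])

/-- A space that contains the primitive harmonic polynomials of degree `k` and is stable under the
lowering operator contains all harmonic polynomials of degree `k`. -/
theorem harmBideg_le_of_primitives_le {U : Submodule ℂ (Poly n)} {k : ℕ}
    (hU : ∀ γ ≤ k / 2, primitives n (k - γ) γ ≤ U) (hF : ∀ f ∈ U, lowerOp n f ∈ U) {q : ℕ}
    (hq : q ≤ k) : harmBideg n (k - q) q ≤ U := by
  induction q with
  | zero =>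
    intro f hf
    exact hU 0 (Nat.zero_le _) ⟨hf, raiseOp_eq_zero hf.1⟩
  | succ q ih =>
    rw [← harmBideg_succ]
    refine sup_le ?_ ?_
    · by_cases h : q + 1 ≤ k / 2
      · exact hU _ h
      · intro f hf
        rw [eq_zero_of_raiseOp_eq_zero (by omega) hf.1.1 hf.2]
        exact U.zero_mem
    · rintro _ ⟨f, hf, rfl⟩
      have e : k - (q + 1) + 1 = k - q := by omega
      rw [e] at hf
      exact hF _ (ih (by omega) hf)

/-- A homogeneous harmonic polynomial is a sum of bihomogeneous harmonic polynomials. -/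
theorem homogeneous_harmonic_le {U : Submodule ℂ (Poly n)} {k : ℕ}
    (hU : ∀ q ≤ k, harmBideg n (k - q) q ≤ U) {f : Poly n} (hf : f.IsHomogeneous k)
    (hl : laplacian n f = 0) : f ∈ U := by
  classical
  let B : ℕ → Poly n := fun q => weightedHomogeneousComponent
    (Sum.elim (fun _ => 0) (fun _ => 1) : (Fin n ⊕ Fin n) ⊕ (Fin n ⊕ Fin n) → ℕ) q f
  have hc : ∀ q s, coeff s (B q) = if ∑ c, s (Sum.inr c) = q then coeff s f else 0 := by
    intro q s
    have hw : Finsupp.weight (Sum.elim (fun _ => 0) (fun _ => 1) :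
        (Fin n ⊕ Fin n) ⊕ (Fin n ⊕ Fin n) → ℕ) s = ∑ c, s (Sum.inr c) := by
      rw [Finsupp.weight_apply, Finsupp.sum_fintype _ _ (by simp), Fintype.sum_sum_type]
      simp
    rw [coeff_weightedHomogeneousComponent, hw]
  have hdeg : ∀ s, coeff s f ≠ 0 → ∑ c, s (Sum.inl c) + ∑ c, s (Sum.inr c) = k := by
    intro s hs
    have h := hf hs
    rw [Finsupp.weight_apply, Finsupp.sum_fintype _ _ (by simp), Fintype.sum_sum_type] at h
    simpa using h
  have hBmem : ∀ q, B q ∈ bideg n (k - q) q := by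
    intro q
    rw [mem_bideg_iff]
    intro s hs
    rw [hc] at hs
    split_ifs at hs with h
    · have := hdeg s hs
      omega
    · exact absurd rfl hs
  have hsum : f = ∑ q ∈ Finset.range (k + 1), B q := by
    ext s
    rw [coeff_sum]
    simp only [hc]
    rw [Finset.sum_ite_eq]
    split_ifs with h
    · rfl
    · by_contra hs
      have := hdeg s hs
      rw [Finset.mem_range] at h
      omega
  have hB0 : laplacian n (B 0) = 0 := laplacian_eq_zero_of_right (hBmem 0)
  have hBl : ∀ q ≤ k, laplacian n (B q) = 0 := by
    intro q hq
    rcases q with _ | q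
    · exact hB0
    · refine eq_zero_of_sum_bideg (T := Finset.range k) (B := fun q => laplacian n (B (q + 1)))
        (d := id) Function.injective_id.injOn (fun q hq => ?_) ?_
        (Finset.mem_range.2 (Nat.lt_of_succ_le hq))
      · have h1 := hBmem (q + 1)
        obtain h2 | ⟨p, h2⟩ : k - (q + 1) = 0 ∨ ∃ p, k - (q + 1) = p + 1 := by
          rcases k - (q + 1) with _ | p
          · exact Or.inl rfl
          · exact Or.inr ⟨p, rfl⟩
        · rw [h2] at h1
          exact ⟨0, by rw [laplacian_eq_zero_of_left h1]; exact Submodule.zero_mem _⟩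
        · rw [h2] at h1
          exact ⟨p, laplacian_mem_bideg h1⟩
      · rw [hsum, map_sum, Finset.sum_range_succ', hB0, add_zero] at hl
        exact hl
  rw [hsum]
  exact Submodule.sum_mem _ fun q hq =>
    hU q (Nat.lt_succ_iff.1 (Finset.mem_range.1 hq))
      ⟨hBmem q, hBl q (Nat.lt_succ_iff.1 (Finset.mem_range.1 hq))⟩

/-- Lowered primitive polynomials of a common bidegree are linearly independent if the primitive
polynomials are. -/
theorem eq_zero_of_sum_weightPoly {I : Type*} [Fintype I] {k : ℕ} (γ : I → ℕ) (a b : I → Pt n)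
    (hli : ∀ (q : ℕ) (g : I → ℂ), (∀ i, γ i ≠ q → g i = 0) →
      ∑ i, g i • weightPoly (a i) (b i) (k - γ i - γ i) 0 (γ i) = 0 → g = 0)
    (q : ℕ) (g : I → ℂ) (hg : ∀ i, ¬ (γ i ≤ q ∧ q ≤ k - γ i) → g i = 0)
    (h : ∑ i, g i • weightPoly (a i) (b i) (k - γ i - q) (q - γ i) (γ i) = 0) : g = 0 := by
  -- It suffices to see that only the indices with `γ i = q` contribute.
  have key : ∀ (q : ℕ) (g : I → ℂ),
      ∑ i, g i • weightPoly (a i) (b i) (k - γ i - q) (q - γ i) (γ i) = 0 →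
      (∀ i, γ i ≠ q → g i = 0) → g = 0 := by
    intro q g h hs
    refine hli q g hs ?_
    rw [← h]
    refine Finset.sum_congr rfl fun i _ => ?_
    by_cases hi : γ i = q
    · rw [hi, Nat.sub_self]
    · rw [hs i hi, zero_smul, zero_smul]
  induction q generalizing g with
  | zero => exact key 0 g h fun i hi => hg i fun h => hi (Nat.le_zero.1 h.1)
  | succ q ih =>
    refine key (q + 1) g h ?_
    have h1 := congrArg (raiseOp n) h
    rw [map_sum, map_zero] at h1
    have h2 : ∑ i, (g i * (q + 1 - γ i : ℕ)) •
        weightPoly (a i) (b i) (k - γ i - q) (q - γ i) (γ i) = 0 := by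
      rw [← h1]
      refine Finset.sum_congr rfl fun i _ => ?_
      by_cases hi : γ i ≤ q + 1 ∧ q + 1 ≤ k - γ i
      · rw [Derivation.map_smul]
        obtain hi' | hi' : γ i = q + 1 ∨ γ i ≤ q := by omega
        · rw [hi', Nat.sub_self, raiseOp_weightPoly_zero, Nat.cast_zero, mul_zero, zero_smul,
            smul_zero]
        · have e1 : q + 1 - γ i = q - γ i + 1 := by omega
          have e2 : k - γ i - q = k - γ i - (q + 1) + 1 := by omega
          rw [e1, raiseOp_weightPoly_succ, smul_smul, ← e2]
      · rw [hg i hi, zero_mul, zero_smul, zero_smul, map_zero]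
    have h3 := ih (fun i => g i * (q + 1 - γ i : ℕ)) (fun i hi => ?_) h2
    · intro i hi
      by_cases hi' : γ i ≤ q + 1
      · have h4 : g i * (q + 1 - γ i : ℕ) = 0 := congrFun h3 i
        exact (mul_eq_zero.1 h4).resolve_right (Nat.cast_ne_zero.2 (by omega))
      · exact hg i fun h => hi' h.1
    · by_cases hi' : γ i ≤ q
      · rw [hg i (by omega), zero_mul]
      · rw [show q + 1 - γ i = 0 by omega, Nat.cast_zero, mul_zero]

/-! ### The representations of `Sp(1)` -/

/-- The weight vectors of `W`, indexed by their degree in the conjugate coordinates. -/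
noncomputable def weightFun (n : ℕ) (hn : 2 ≤ n) (k γ q : ℕ) : Pt n → ℂ :=
  polyFun n (weightPoly (baseOne hn) (baseTwo hn) (k - γ - q) (q - γ) γ)

theorem hwPoly_eq_weightFun (hn : 2 ≤ n) {k γ α : ℕ} (hα : α ≤ k) :
    hwPoly n hn γ α (k - α) = weightFun n hn k γ (k - α) := by
  rw [hwPoly_eq_polyFun, weightFun, baseOne, baseTwo]
  congr 2
  omega

theorem spWSubmodule_eq (hn : 2 ≤ n) {k γ : ℕ} (hγ : γ ≤ k / 2) : spWSubmodule n hn k γ =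
    Submodule.span ℂ (weightFun n hn k γ '' {q | γ ≤ q ∧ q ≤ k - γ}) := by
  rw [spWSubmodule]
  congr 1
  ext f
  constructor
  · rintro ⟨α, h1, h2, rfl⟩
    exact ⟨k - α, ⟨by omega, by omega⟩, (hwPoly_eq_weightFun hn (by omega)).symm⟩
  · rintro ⟨q, ⟨h1, h2⟩, rfl⟩
    refine ⟨k - q, by omega, by omega, ?_⟩
    rw [hwPoly_eq_weightFun hn (by omega), Nat.sub_sub_self (by omega)]

theorem weightFun_mem (hn : 2 ≤ n) {k γ q : ℕ} (hγ : γ ≤ k / 2) (h1 : γ ≤ q) (h2 : q ≤ k - γ) :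
    weightFun n hn k γ q ∈ spWSubmodule n hn k γ := by
  rw [spWSubmodule_eq hn hγ]
  exact Submodule.subset_span ⟨q, ⟨h1, h2⟩, rfl⟩

theorem weightPoly_mem_bideg_of_le (a b : Pt n) {k γ q : ℕ} (h1 : γ ≤ q) (h2 : q ≤ k - γ) :
    weightPoly a b (k - γ - q) (q - γ) γ ∈ bideg n (k - q) q := by
  have h := weightPoly_mem_bideg a b (k - γ - q) (q - γ) γ
  rwa [show k - γ - q + γ = k - q by omega, show q - γ + γ = q by omega] at h

/-- Elements of `W` as combinations of weight vectors, with coefficients indexed by the degree in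
the conjugate coordinates. -/
theorem exists_eq_sum_weightFun (hn : 2 ≤ n) {k γ : ℕ} (hγ : γ ≤ k / 2) {w : Pt n → ℂ}
    (hw : w ∈ spWSubmodule n hn k γ) : ∃ g : ℕ → ℂ, (∀ q, ¬ (γ ≤ q ∧ q ≤ k - γ) → g q = 0) ∧
      w = ∑ q ∈ Finset.range (k + 1), g q • weightFun n hn k γ q := by
  rw [spWSubmodule_eq hn hγ] at hw
  induction hw using Submodule.span_induction with
  | mem f hf =>
    obtain ⟨q, ⟨h1, h2⟩, rfl⟩ := hf
    refine ⟨Pi.single q 1, fun r hr => Pi.single_eq_of_ne (fun h => ?_) _, ?_⟩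
    · exact hr (by rw [h]; exact ⟨h1, h2⟩)
    rw [Finset.sum_eq_single_of_mem q (Finset.mem_range.2 (by omega)) fun r _ hr => by
      rw [Pi.single_eq_of_ne hr, zero_smul], Pi.single_eq_same, one_smul]
  | zero => exact ⟨0, fun _ _ => rfl, by simp⟩
  | add f f' _ _ hf hf' =>
    obtain ⟨g, h1, rfl⟩ := hf
    obtain ⟨g', h1', rfl⟩ := hf'
    refine ⟨g + g', fun q hq => by rw [Pi.add_apply, h1 q hq, h1' q hq, add_zero], ?_⟩
    rw [← Finset.sum_add_distrib]
    exact Finset.sum_congr rfl fun q _ => (add_smul _ _ _).symm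
  | smul c f _ hf =>
    obtain ⟨g, h1, rfl⟩ := hf
    refine ⟨c • g, fun q hq => by rw [Pi.smul_apply, h1 q hq, smul_zero], ?_⟩
    rw [Finset.smul_sum]
    exact Finset.sum_congr rfl fun q _ => by rw [Pi.smul_apply, smul_eq_mul, mul_smul]

/-- The element of `Sp(1)` with first column `(a, b)`. -/
noncomputable def sp1Mk (a b : ℂ) (h : a * conj a + b * conj b = 1) : Sp1 :=
  ⟨!![a, -conj b; b, conj a], by
    rw [Matrix.mem_specialUnitaryGroup_iff, Matrix.mem_unitaryGroup_iff, Matrix.det_fin_two_of]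
    refine ⟨?_, by linear_combination h⟩
    ext i j
    fin_cases i <;> fin_cases j <;>
      simp [Matrix.mul_apply, Fin.sum_univ_two, Matrix.star_apply]
    · linear_combination h
    · ring
    · ring
    · linear_combination h⟩

/-- A subspace that is invariant under the right action contains the bihomogeneous components of
its elements: they are separated by the action of the diagonal torus. -/
theorem mem_of_sum_bideg_mem {S : Submodule ℂ (Pt n → ℂ)}
    (hS : ∀ (q : Sp1), ∀ f ∈ S, rightRep n q f ∈ S) {k : ℕ} {B : ℕ → Poly n}
    (hB : ∀ q ≤ k, B q ∈ bideg n (k - q) q)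
    (h : ∑ q ∈ Finset.range (k + 1), polyFun n (B q) ∈ S) {q : ℕ} (hq : q ≤ k) :
    polyFun n (B q) ∈ S := by
  have hT : (Metric.sphere (0 : ℂ) 1).Infinite :=
    (isPreconnected_sphere (by rw [Complex.rank_real_complex]; exact Cardinal.one_lt_two)
      0 1).infinite_of_nontrivial ⟨1, by simp, -1, by simp, by norm_num⟩
  refine mem_of_forall_sum_pow_smul_mem S hT (k + 1) (fun q => polyFun n (B q)) (fun t ht => ?_) q
    (Nat.lt_succ_of_le hq)
  obtain ⟨ζ, hζ⟩ : ∃ ζ : ℂ, ζ * ζ = t := (IsAlgClosed.exists_eq_mul_self t).imp fun _ h => h.symm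
  have hζ1 : conj ζ * ζ = 1 := by
    have h1 : ‖ζ‖ * ‖ζ‖ = 1 := by rw [← norm_mul, hζ]; simpa using ht
    rw [← Complex.normSq_eq_conj_mul_self, Complex.normSq_eq_norm_sq, sq, h1, Complex.ofReal_one]
  have hact : ∀ q ≤ k, ζ ^ k • rightRep n (sp1Mk (conj ζ) 0 (by simpa using hζ1))
      (polyFun n (B q)) = t ^ q • polyFun n (B q) := by
    intro q hq
    funext x
    have e : rmul (sp1Mk (conj ζ) 0 (by simpa using hζ1)).1 x = conj ζ • x := by
      rw [rmul_eq]
      simp [sp1Mk]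
    have e2 : (fun c => conj ((conj ζ • x) c)) = ζ • fun c => conj (x c) := by
      funext c
      simp
    have h1 := eval_smul_smul (hB q hq) (conj ζ) ζ x (fun c => conj (x c))
    rw [← e2] at h1
    rw [Pi.smul_apply, rightRep_apply, e, Pi.smul_apply]
    change ζ ^ k * eval _ _ = t ^ q * eval _ _
    rw [h1, ← hζ, mul_pow, ← mul_assoc, ← mul_assoc]
    congr 1
    have e3 : ζ ^ k = ζ ^ (k - q) * ζ ^ q := by rw [← pow_add, Nat.sub_add_cancel hq]
    have e4 : conj ζ ^ (k - q) * ζ ^ (k - q) = 1 := by rw [← mul_pow, hζ1, one_pow]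
    rw [e3]
    linear_combination ζ ^ q * ζ ^ q * e4
  have h2 := S.smul_mem (ζ ^ k) (hS (sp1Mk (conj ζ) 0 (by simpa using hζ1)) _ h)
  rw [map_sum, Finset.smul_sum] at h2
  rwa [Finset.sum_congr rfl fun q hq => hact q (Nat.lt_succ_iff.1 (Finset.mem_range.1 hq))] at h2

theorem weightPoly_base_mem_harmBideg (hn : 2 ≤ n) {k γ q : ℕ} (h1 : γ ≤ q) (h2 : q ≤ k - γ) :
    weightPoly (baseOne hn) (baseTwo hn) (k - γ - q) (q - γ) γ ∈ harmBideg n (k - q) q :=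
  ⟨weightPoly_mem_bideg_of_le _ _ h1 h2,
    laplacian_weightPoly (baseOne_dotProduct_rot_baseTwo hn) _ _ _⟩

theorem bideg_le_homogeneousSubmodule (p q : ℕ) :
    bideg n p q ≤ homogeneousSubmodule _ ℂ (p + q) := by
  intro f hf s hs
  obtain ⟨h1, h2⟩ := mem_bideg_iff.1 hf s hs
  rw [Finsupp.weight_apply, Finsupp.sum_fintype _ _ (by simp), Fintype.sum_sum_type]
  simpa [-Fintype.sum_sum_type] using congrArg₂ (· + ·) h1 h2

theorem map_harmBideg_le_harmSubmodule {k q : ℕ} (hq : q ≤ k) :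
    (harmBideg n (k - q) q).map (polyFun n) ≤ harmSubmodule n k := by
  refine Submodule.map_mono (inf_le_inf_right _ ?_)
  have h := bideg_le_homogeneousSubmodule (n := n) (k - q) q
  rwa [Nat.sub_add_cancel hq] at h

theorem spWSubmodule_le_harmSubmodule (hn : 2 ≤ n) {k γ : ℕ} (hγ : γ ≤ k / 2) :
    spWSubmodule n hn k γ ≤ harmSubmodule n k := by
  rw [spWSubmodule_eq hn hγ, Submodule.span_le]
  rintro _ ⟨q, ⟨h1, h2⟩, rfl⟩
  exact map_harmBideg_le_harmSubmodule (by omega) ⟨_, weightPoly_base_mem_harmBideg hn h1 h2, rfl⟩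

theorem weightFun_apply (hn : 2 ≤ n) (k γ q : ℕ) (x : Pt n) : weightFun n hn k γ q x =
    x (Sum.inr ⟨0, by omega⟩) ^ (k - γ - q) * conj (x (Sum.inl ⟨0, by omega⟩)) ^ (q - γ) *
      (x (Sum.inr ⟨1, by omega⟩) * conj (x (Sum.inl ⟨0, by omega⟩))
        - x (Sum.inr ⟨0, by omega⟩) * conj (x (Sum.inl ⟨1, by omega⟩))) ^ γ := by
  have h := congrFun (hwPoly_eq_polyFun hn γ (k - γ - q + γ) q) x
  rw [hwPoly, Nat.add_sub_cancel] at h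
  exact h.symm

/-- A point at which only the highest weight vector of `W` does not vanish. -/
theorem weightFun_apply_point (hn : 2 ≤ n) (k γ q : ℕ) : weightFun n hn k γ q
    (Sum.elim (Pi.single ⟨1, by omega⟩ (-1)) (Pi.single ⟨0, by omega⟩ 1)) = 0 ^ (q - γ) := by
  rw [weightFun_apply]
  simp

theorem weightFun_apply_ne_zero (hn : 2 ≤ n) (k γ q : ℕ) : weightFun n hn k γ q ≠ 0 := by
  intro h0
  have h1 := congrFun h0 (Sum.elim (Pi.single ⟨0, by omega⟩ 1) 1)
  rw [weightFun_apply] at h1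
  simp at h1

/-- The effect of the right action on the weight vectors. -/
theorem weightFun_rmul (hn : 2 ≤ n) (k γ q : ℕ) (M : Matrix (Fin 2) (Fin 2) ℂ) (x : Pt n) :
    weightFun n hn k γ q (rmul M x) =
      (M 0 0 * x (Sum.inr ⟨0, by omega⟩) + M 1 0 * conj (x (Sum.inl ⟨0, by omega⟩))) ^ (k - γ - q) *
      (conj (M 0 0) * conj (x (Sum.inl ⟨0, by omega⟩)) -
        conj (M 1 0) * x (Sum.inr ⟨0, by omega⟩)) ^ (q - γ) *
      ((M 0 0 * conj (M 0 0) + M 1 0 * conj (M 1 0)) *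
        (x (Sum.inr ⟨1, by omega⟩) * conj (x (Sum.inl ⟨0, by omega⟩))
          - x (Sum.inr ⟨0, by omega⟩) * conj (x (Sum.inl ⟨1, by omega⟩)))) ^ γ := by
  rw [weightFun_apply]
  simp only [rmul, Sum.elim_inl, Sum.elim_inr, map_sub, map_mul, Complex.conj_conj]
  congr 2
  ring

/-- Every nonzero invariant subspace of `W` is everything. -/
theorem le_of_invariant (hn : 2 ≤ n) {k γ : ℕ} (hγ : γ ≤ k / 2) {S : Submodule ℂ (Pt n → ℂ)}
    (hS : ∀ (q : Sp1), ∀ f ∈ S, rightRep n q f ∈ S) (hSW : S ≤ spWSubmodule n hn k γ)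
    (hS0 : S ≠ ⊥) : spWSubmodule n hn k γ ≤ S := by
  -- The weight components of elements of `S` lie in `S`.
  have hcomp : ∀ g : ℕ → ℂ, (∀ q, ¬ (γ ≤ q ∧ q ≤ k - γ) → g q = 0) →
      ∑ q ∈ Finset.range (k + 1), g q • weightFun n hn k γ q ∈ S →
      ∀ q, g q ≠ 0 → weightFun n hn k γ q ∈ S := by
    intro g hg h q hq
    have hqq : γ ≤ q ∧ q ≤ k - γ := not_imp_comm.1 (hg q) hq
    have h1 := mem_of_sum_bideg_mem hS (k := k) (q := q)
      (B := fun q => g q • weightPoly (baseOne hn) (baseTwo hn) (k - γ - q) (q - γ) γ)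
      (fun r _ => by
        by_cases hr : γ ≤ r ∧ r ≤ k - γ
        · exact Submodule.smul_mem _ _ (weightPoly_mem_bideg_of_le _ _ hr.1 hr.2)
        · rw [hg r hr, zero_smul]
          exact Submodule.zero_mem _)
      (by simp only [map_smul]; exact h) (by omega)
    rw [map_smul] at h1
    exact (S.smul_mem_iff hq).1 h1
  have hc3 : conj (3 / 5 : ℂ) = 3 / 5 := by rw [map_div₀, map_ofNat, map_ofNat]
  have hc4 : conj (4 / 5 : ℂ) = 4 / 5 := by rw [map_div₀, map_ofNat, map_ofNat]
  -- A rotation of which both entries are nonzero.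
  have hab : (3 / 5 : ℂ) * conj (3 / 5 : ℂ) + (4 / 5 : ℂ) * conj (4 / 5 : ℂ) = 1 := by
    rw [hc3, hc4]
    norm_num
  -- The highest weight component of a rotated weight vector does not vanish.
  have htop : weightFun n hn k γ γ ∈ S := by
    obtain ⟨f, hf, hf0⟩ := Submodule.exists_mem_ne_zero_of_ne_bot hS0
    obtain ⟨g, hg, rfl⟩ := exists_eq_sum_weightFun hn hγ (hSW hf)
    obtain ⟨q, hq⟩ : ∃ q, g q ≠ 0 := by
      by_contra! h
      exact hf0 (Finset.sum_eq_zero fun q _ => by rw [h, zero_smul])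
    have h1 := hS (sp1Mk (3 / 5) (4 / 5) hab) _ (hcomp g hg hf q hq)
    obtain ⟨g', hg', h2⟩ := exists_eq_sum_weightFun hn hγ (hSW h1)
    rw [h2] at h1
    refine hcomp g' hg' h1 γ fun h0 => ?_
    have h3 := congrFun h2
      (Sum.elim (Pi.single ⟨1, by omega⟩ (-1)) (Pi.single ⟨0, by omega⟩ 1))
    rw [Finset.sum_apply, Finset.sum_eq_zero fun r hr => ?_, rightRep_apply, weightFun_rmul] at h3
    · revert h3
      simp [sp1Mk, -map_div₀, hc3, hc4]
      norm_num
    · rw [Pi.smul_apply, weightFun_apply_point, smul_eq_mul]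
      rcases lt_trichotomy r γ with hr | hr | hr
      · rw [hg' r (by omega), zero_mul]
      · rw [hr, h0, zero_mul]
      · rw [zero_pow (by omega), mul_zero]
  have h1 := hS (sp1Mk (3 / 5) (4 / 5) hab) _ htop
  -- By the binomial formula, all weights occur in the rotated highest weight vector.
  have h2 : rightRep n (sp1Mk (3 / 5) (4 / 5) hab) (weightFun n hn k γ γ) =
      ∑ q ∈ Finset.range (k + 1), (if γ ≤ q ∧ q ≤ k - γ then
        (3 / 5 : ℂ) ^ (k - γ - q) * (4 / 5) ^ (q - γ) * (k - γ - γ).choose (q - γ) else 0) •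
        weightFun n hn k γ q := by
    funext x
    rw [rightRep_apply, weightFun_rmul, Finset.sum_apply, sp1_norm, Nat.sub_self, pow_zero,
      mul_one, one_mul, add_comm, add_pow, Finset.sum_mul]
    refine Finset.sum_of_injOn (γ + ·) (add_right_injective γ).injOn (fun i hi => ?_)
      (fun q _ hq => ?_) fun i hi => ?_
    · have := Finset.mem_range.1 hi
      exact Finset.mem_coe.2 (Finset.mem_range.2 (by simp only; omega))
    · rw [if_neg, zero_smul, Pi.zero_apply]
      rintro ⟨h1, h2⟩
      exact hq ⟨q - γ, Finset.mem_coe.2 (Finset.mem_range.2 (by omega)), by simp only; omega⟩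
    · have := Finset.mem_range.1 hi
      rw [if_pos ⟨by omega, by omega⟩, Pi.smul_apply, weightFun_apply, Nat.add_sub_cancel_left,
        ← Nat.sub_sub, mul_pow, mul_pow]
      simp [sp1Mk]
      ring
  rw [h2] at h1
  rw [spWSubmodule_eq hn hγ, Submodule.span_le]
  rintro _ ⟨q, hq, rfl⟩
  refine hcomp _ (fun r hr => if_neg hr) h1 q ?_
  obtain ⟨hq1, hq2⟩ := hq
  rw [if_pos ⟨hq1, hq2⟩]
  have h3 : ((k - γ - γ).choose (q - γ) : ℂ) ≠ 0 :=
    Nat.cast_ne_zero.2 (Nat.choose_pos (by omega)).ne'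
  refine mul_ne_zero (mul_ne_zero (pow_ne_zero _ (by norm_num)) (pow_ne_zero _ (by norm_num))) h3

theorem spW_isIrreducible (hn : 2 ≤ n) {k γ : ℕ} (hγ : γ ≤ k / 2) :
    (spW n hn k γ).toRepresentation.IsIrreducible := by
  have hne : (⟨weightFun n hn k γ γ, weightFun_mem hn hγ le_rfl (by omega)⟩ :
      (spW n hn k γ).toSubmodule) ≠ 0 := fun h =>
    weightFun_apply_ne_zero hn k γ γ (congrArg Subtype.val h)
  refine { exists_pair_ne := ⟨⊥, ⊤, fun h => hne ?_⟩, eq_bot_or_eq_top := fun S => ?_ }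
  · have h1 : (⟨weightFun n hn k γ γ, weightFun_mem hn hγ le_rfl (by omega)⟩ :
      (spW n hn k γ).toSubmodule) ∈ (⊤ : Subrepresentation (spW n hn k γ).toRepresentation) := by
      exact Submodule.mem_top
    rw [← h] at h1
    exact (Submodule.mem_bot ℂ).1 h1
  · by_cases hS : S.toSubmodule = ⊥
    · left
      exact Subrepresentation.toSubmodule_injective hS
    · right
      refine Subrepresentation.toSubmodule_injective ?_
      have h1 := le_of_invariant hn hγ (S := S.toSubmodule.map (spW n hn k γ).toSubmodule.subtype)
        ?_ (Submodule.map_subtype_le _ _) ?_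
      · refine eq_top_iff.2 fun x _ => ?_
        obtain ⟨y, hy, hyx⟩ := h1 x.2
        rwa [← Subtype.ext hyx]
      · rintro q _ ⟨y, hy, rfl⟩
        exact ⟨_, S.apply_mem_toSubmodule q hy, rfl⟩
      · intro h
        exact hS ((Submodule.map_injective_of_injective (Submodule.injective_subtype _)
          (h.trans (Submodule.map_bot _).symm)))

theorem finrank_spWSubmodule (hn : 2 ≤ n) {k γ : ℕ} (hγ : γ ≤ k / 2) :
    Module.finrank ℂ (spWSubmodule n hn k γ) = k - 2 * γ + 1 := by
  have e : weightFun n hn k γ '' {q | γ ≤ q ∧ q ≤ k - γ} =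
      Set.range fun i : Fin (k - 2 * γ + 1) => weightFun n hn k γ (γ + i) := by
    ext f
    constructor
    · rintro ⟨q, ⟨h1, h2⟩, rfl⟩
      exact ⟨⟨q - γ, by omega⟩, by simp only; rw [Nat.add_sub_cancel' h1]⟩
    · rintro ⟨i, rfl⟩
      exact ⟨γ + i, ⟨by omega, by omega⟩, rfl⟩
  rw [spWSubmodule_eq hn hγ, e, finrank_span_eq_card, Fintype.card_fin]
  rw [Fintype.linearIndependent_iff]
  intro g hg i
  have h1 : ∑ i : Fin (k - 2 * γ + 1), g i •
      weightPoly (baseOne hn) (baseTwo hn) (k - γ - (γ + i)) (γ + i - γ) γ = 0 := by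
    refine polyFun_injective n ?_
    rw [map_sum, map_zero, ← hg]
    exact Finset.sum_congr rfl fun i _ => map_smul _ _ _
  have h2 := eq_zero_of_sum_bideg (d := fun i : Fin (k - 2 * γ + 1) => γ + (i : ℕ))
    (fun i _ j _ hij => Fin.ext (by simpa using hij))
    (fun i _ => ⟨_, Submodule.smul_mem _ _
      (weightPoly_mem_bideg_of_le (k := k) _ _ (by omega) (by omega))⟩) h1 (Finset.mem_univ i)
  have h3 := congrArg (polyFun n) h2
  rw [map_smul, map_zero] at h3
  exact (smul_eq_zero.1 h3).resolve_right (weightFun_apply_ne_zero hn k γ _)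

theorem natCast_mul_pow_pred_mul (m : ℕ) (w : ℂ) : (m : ℂ) * w ^ (m - 1) * w = m * w ^ m := by
  rcases m with _ | m
  · simp
  · rw [Nat.add_sub_cancel, pow_succ, mul_assoc]

/-- The derivative of the right action on the highest weight vector. If the exponent `k - γ - γ` is
zero, the truncated exponent `k - γ - γ - 1` does not matter, as its coefficient vanishes. -/
theorem dRightReal_weightFun (hn : 2 ≤ n) (k γ : ℕ) (A : Matrix (Fin 2) (Fin 2) ℂ) (x : Pt n) :
    dRightReal A (weightFun n hn k γ γ) x =
      (((k - γ - γ : ℕ) : ℂ) * x (Sum.inr ⟨0, by omega⟩) ^ (k - γ - γ - 1) *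
        (A 0 0 * x (Sum.inr ⟨0, by omega⟩) + A 1 0 * conj (x (Sum.inl ⟨0, by omega⟩))) +
      x (Sum.inr ⟨0, by omega⟩) ^ (k - γ - γ) * (γ * (A 0 0 + conj (A 0 0)))) *
      (x (Sum.inr ⟨1, by omega⟩) * conj (x (Sum.inl ⟨0, by omega⟩))
          - x (Sum.inr ⟨0, by omega⟩) * conj (x (Sum.inl ⟨1, by omega⟩))) ^ γ := by
  have hE : ∀ i j, HasDerivAt (fun t : ℝ => (NormedSpace.exp (t • A)) i j) (A i j) 0 := by
    intro i j
    let := Matrix.linftyOpNormedRing (n := Fin 2) (α := ℂ)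
    let := Matrix.linftyOpNormedAlgebra (R := ℝ) (n := Fin 2) (α := ℂ)
    have h := hasDerivAt_exp_smul_const (𝕂 := ℝ) A (0 : ℝ)
    rw [zero_smul, NormedSpace.exp_zero, one_mul] at h
    have h2 := hasDerivAt_pi.1 h i
    exact hasDerivAt_pi.1 h2 j
  have hconj : ∀ {f : ℝ → ℂ} {f' : ℂ}, HasDerivAt f f' 0 →
      HasDerivAt (fun t => conj (f t)) (conj f') 0 := by
    intro f f' hf
    exact hf.star
  have hd := ((((hE 0 0).mul_const (x (Sum.inr ⟨0, by omega⟩))).add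
    ((hE 1 0).mul_const (conj (x (Sum.inl ⟨0, by omega⟩))))).pow (k - γ - γ)).mul
    (((((hE 0 0).mul (hconj (hE 0 0))).add ((hE 1 0).mul (hconj (hE 1 0)))).mul_const
      (x (Sum.inr ⟨1, by omega⟩) * conj (x (Sum.inl ⟨0, by omega⟩))
          - x (Sum.inr ⟨0, by omega⟩) * conj (x (Sum.inl ⟨1, by omega⟩)))).pow γ)
  unfold dRightReal
  simp only [weightFun_rmul, Nat.sub_self, pow_zero, mul_one]
  refine (hd.deriv).trans ?_
  simp
  linear_combination x (Sum.inr ⟨0, by omega⟩) ^ (k - γ - γ) * (A 0 0 + conj (A 0 0)) *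
    natCast_mul_pow_pred_mul γ (x (Sum.inr ⟨1, by omega⟩) * conj (x (Sum.inl ⟨0, by omega⟩))
          - x (Sum.inr ⟨0, by omega⟩) * conj (x (Sum.inl ⟨1, by omega⟩)))

theorem spW_hasHighestWeight (hn : 2 ≤ n) {k γ : ℕ} (hγ : γ ≤ k / 2) :
    HasHighestWeight (spW n hn k γ) (k - 2 * γ) := by
  refine ⟨weightFun n hn k γ γ, weightFun_mem hn hγ le_rfl (by omega),
    weightFun_apply_ne_zero hn k γ γ, ?_, ?_⟩
  · funext x
    rw [dRight, Pi.add_apply, Pi.smul_apply, dRightReal_weightFun, dRightReal_weightFun]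
    simp
    linear_combination (-((k - γ - γ : ℕ) : ℂ) * x (Sum.inr ⟨0, by omega⟩) ^ (k - γ - γ - 1) *
      conj (x (Sum.inl ⟨0, by omega⟩)) * (x (Sum.inr ⟨1, by omega⟩) *
        conj (x (Sum.inl ⟨0, by omega⟩)) - x (Sum.inr ⟨0, by omega⟩) *
        conj (x (Sum.inl ⟨1, by omega⟩))) ^ γ / 2) * Complex.I_mul_I
  · funext x
    rw [dRight, Pi.add_apply, Pi.smul_apply, dRightReal_weightFun, dRightReal_weightFun,
      Pi.smul_apply, weightFun_apply, Nat.sub_self, pow_zero, mul_one,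
      show k - 2 * γ = k - γ - γ by omega]
    simp
    have h := natCast_mul_pow_pred_mul (k - γ - γ) (x (Sum.inr ⟨0, by omega⟩))
    generalize (x (Sum.inr ⟨1, by omega⟩) * conj (x (Sum.inl ⟨0, by omega⟩)) -
      x (Sum.inr ⟨0, by omega⟩) * conj (x (Sum.inl ⟨1, by omega⟩))) ^ γ = D
    rw [show conj (2 : ℂ) = 2 from map_ofNat _ 2]
    linear_combination D * h - ((k - γ - γ : ℕ) : ℂ) * x (Sum.inr ⟨0, by omega⟩) ^ (k - γ - γ - 1) *
      x (Sum.inr ⟨0, by omega⟩) * D * Complex.I_mul_I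

/-- Distinct spaces `W` have distinct dimensions. -/
theorem isEmpty_equiv (hn : 2 ≤ n) {k γ γ' : ℕ} (hγ : γ ≤ k / 2) (hγ' : γ' ≤ k / 2)
    (h : γ ≠ γ') : IsEmpty ((spW n hn k γ).toRepresentation.Equiv
      (spW n hn k γ').toRepresentation) := by
  refine ⟨fun φ => h ?_⟩
  have h1 : Module.finrank ℂ (spWSubmodule n hn k γ) = Module.finrank ℂ (spWSubmodule n hn k γ') :=
    φ.toLinearEquiv.finrank_eq
  rw [finrank_spWSubmodule hn hγ, finrank_spWSubmodule hn hγ'] at h1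
  omega

/-- The dimension formula for the multiplicities. -/
theorem spDim_formula (hn : 2 ≤ n) {k γ : ℕ} (hγ : γ ≤ k / 2) : (spDim n hn k γ : ℚ) =
    (Nat.factorial (k - γ + 2 * n - 2) * Nat.factorial (γ + 2 * n - 3) *
        (k - 2 * γ + 1) * (k + 2 * n - 1) : ℚ) /
      (Nat.factorial (k - γ + 1) * Nat.factorial γ * Nat.factorial (2 * n - 1) *
        Nat.factorial (2 * n - 3)) := by
  rw [spDim_eq hn hγ, finrank_primitives hn (k - γ) γ (by omega),
    Nat.cast_sub (show γ ≤ k by omega)]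
  congr 1
  ring

/-! ### The isotypic decomposition -/

theorem leftActLin_weightFun (hn : 2 ≤ n) {u : Matrix (Fin n ⊕ Fin n) (Fin n ⊕ Fin n) ℂ}
    (hu : u ∈ spGroup n) (k γ q : ℕ) : leftActLin u (weightFun n hn k γ q) =
      polyFun n (weightPoly ((u.map star).mulVec (baseOne hn)) ((u.map star).mulVec (baseTwo hn))
        (k - γ - q) (q - γ) γ) := by
  rw [leftActLin_apply, weightFun, leftAct_weightPoly hu]

theorem leftActLin_mem_harmSubmodule (hn : 2 ≤ n)
    {u : Matrix (Fin n ⊕ Fin n) (Fin n ⊕ Fin n) ℂ} (hu : u ∈ spGroup n) {k γ : ℕ}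
    (hγ : γ ≤ k / 2) {f : Pt n → ℂ} (hf : f ∈ spWSubmodule n hn k γ) :
    leftActLin u f ∈ harmSubmodule n k := by
  have hle : spWSubmodule n hn k γ ≤ (harmSubmodule n k).comap (leftActLin u) := by
    rw [spWSubmodule_eq hn hγ, Submodule.span_le]
    rintro _ ⟨q, ⟨h1, h2⟩, rfl⟩
    change leftActLin u _ ∈ harmSubmodule n k
    rw [leftActLin_weightFun hn hu]
    refine map_harmBideg_le_harmSubmodule (q := q) (by omega)
      ⟨_, ⟨weightPoly_mem_bideg_of_le _ _ h1 h2, laplacian_weightPoly ?_ _ _ _⟩, rfl⟩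
    exact (spGroup_dotProduct_rot hu _ _).trans (baseOne_dotProduct_rot_baseTwo hn)
  exact hle hf

/-- The sum of left translates of the spaces `W`, as a map to the harmonic functions. -/
noncomputable def translateSum (hn : 2 ≤ n) (k : ℕ) {I : Type*} [DecidableEq I] (γ : I → ℕ)
    (hγ : ∀ i, γ i ≤ k / 2) (u : I → Matrix (Fin n ⊕ Fin n) (Fin n ⊕ Fin n) ℂ)
    (hu : ∀ i, u i ∈ spGroup n) :
    (DirectSum I fun i => (spW n hn k (γ i)).toSubmodule) →ₗ[ℂ] harmSubmodule n k :=
  DirectSum.toModule ℂ I _ fun i =>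
    (leftActLin (u i) ∘ₗ (spW n hn k (γ i)).toSubmodule.subtype).codRestrict (harmSubmodule n k)
      fun w => leftActLin_mem_harmSubmodule hn (hu i) (hγ i) w.2

section translateSum

variable (hn : 2 ≤ n) {k : ℕ} {I : Type*} [DecidableEq I] {γ : I → ℕ}
  (hγ : ∀ i, γ i ≤ k / 2) {u : I → Matrix (Fin n ⊕ Fin n) (Fin n ⊕ Fin n) ℂ}
  (hu : ∀ i, u i ∈ spGroup n)

theorem translateSum_lof (i : I) (w : (spW n hn k (γ i)).toSubmodule) :
    (translateSum hn k γ hγ u hu (DirectSum.lof ℂ I _ i w) : Pt n → ℂ) = leftActLin (u i) w := by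
  rw [translateSum, DirectSum.toModule_lof]
  rfl

theorem translateSum_apply [Fintype I]
    (x : DirectSum I fun i => (spW n hn k (γ i)).toSubmodule) :
    (translateSum hn k γ hγ u hu x : Pt n → ℂ) = ∑ i, leftActLin (u i) (x i) := by
  conv_lhs => rw [← DirectSum.sum_univ_of x, map_sum, Submodule.coe_sum]
  exact Finset.sum_congr rfl fun i _ => translateSum_lof hn hγ hu i (x i)

/-- Independence of the translates of the highest weight vectors suffices, because powers of `E`
bring all weights back to the highest ones. -/
theorem translateSum_injective [Fintype I]
    (hli : ∀ (q : ℕ) (g : I → ℂ), (∀ i, γ i ≠ q → g i = 0) →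
      ∑ i, g i • weightPoly (((u i).map star).mulVec (baseOne hn))
        (((u i).map star).mulVec (baseTwo hn)) (k - γ i - γ i) 0 (γ i) = 0 → g = 0) :
    Function.Injective (translateSum hn k γ hγ u hu) := by
  refine (injective_iff_map_eq_zero _).2 fun x hx => ?_
  have h0 : ∑ i, leftActLin (u i) (x i) = 0 := by
    rw [← translateSum_apply hn hγ hu, hx, Submodule.coe_zero]
  choose g hg hxg using fun i => exists_eq_sum_weightFun hn (hγ i) (x i).2
  have h1 : ∑ q ∈ Finset.range (k + 1), ∑ i, g i q •
      weightPoly (((u i).map star).mulVec (baseOne hn)) (((u i).map star).mulVec (baseTwo hn))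
        (k - γ i - q) (q - γ i) (γ i) = 0 := by
    refine polyFun_injective n ?_
    rw [Finset.sum_comm, map_zero, ← h0, map_sum]
    refine Finset.sum_congr rfl fun i _ => ?_
    rw [hxg i, map_sum, map_sum]
    refine Finset.sum_congr rfl fun q _ => ?_
    rw [map_smul, map_smul, leftActLin_weightFun hn (hu i)]
  have h2 : ∀ q ∈ Finset.range (k + 1), (fun i => g i q) = 0 := by
    intro q hq
    refine eq_zero_of_sum_weightPoly γ _ _ hli q _ (fun i hi => hg i q hi) ?_
    refine eq_zero_of_sum_bideg (d := id) Function.injective_id.injOn (fun q _ => ⟨k - q, ?_⟩) h1 hq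
    refine Submodule.sum_mem _ fun i _ => ?_
    by_cases hi : γ i ≤ q ∧ q ≤ k - γ i
    · exact Submodule.smul_mem _ _ (weightPoly_mem_bideg_of_le _ _ hi.1 hi.2)
    · rw [hg i q hi, zero_smul]
      exact Submodule.zero_mem _
  refine DFinsupp.ext fun i => Subtype.ext ?_
  rw [hxg i]
  refine Finset.sum_eq_zero fun q hq => ?_
  rw [congrFun (h2 q hq) i, Pi.zero_apply, zero_smul]

/-- The range is stable under `F`, so that it is everything if it contains the primitive
polynomials. -/
theorem translateSum_surjective
    (hprim : ∀ q ≤ k / 2, primitives n (k - q) q ≤ Submodule.span ℂ (Set.range fun i =>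
      weightPoly (((u i).map star).mulVec (baseOne hn)) (((u i).map star).mulVec (baseTwo hn))
        (k - γ i - γ i) 0 (γ i))) :
    Function.Surjective (translateSum hn k γ hγ u hu) := by
  let B : I → ℕ → Poly n := fun i q =>
    weightPoly (((u i).map star).mulVec (baseOne hn)) (((u i).map star).mulVec (baseTwo hn))
        (k - γ i - q) (q - γ i) (γ i)
  let U : Submodule ℂ (Poly n) := Submodule.span ℂ {f | ∃ i q, γ i ≤ q ∧ q ≤ k - γ i ∧ f = B i q}
  have hU1 : ∀ q ≤ k / 2, primitives n (k - q) q ≤ U := by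
    refine fun q hq => (hprim q hq).trans (Submodule.span_mono ?_)
    rintro _ ⟨i, rfl⟩
    have := hγ i
    exact ⟨i, γ i, le_rfl, by omega, by simp only [B, Nat.sub_self]⟩
  have hU2 : U ≤ U.comap (lowerOp n).toLinearMap := by
    rw [Submodule.span_le]
    rintro _ ⟨i, q, h1, h2, rfl⟩
    change lowerOp n (B i q) ∈ U
    simp only [B]
    rcases h : k - γ i - q with _ | r
    · rw [lowerOp_weightPoly_zero]
      exact U.zero_mem
    · rw [lowerOp_weightPoly_succ]
      refine U.smul_mem _ (Submodule.subset_span ⟨i, q + 1, by omega, by omega, ?_⟩)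
      simp only [B]
      congr 1 <;> omega
  have hU3 : U ≤ (LinearMap.range ((harmSubmodule n k).subtype ∘ₗ
      translateSum hn k γ hγ u hu)).comap (polyFun n) := by
    rw [Submodule.span_le]
    rintro _ ⟨i, q, h1, h2, rfl⟩
    refine ⟨DirectSum.lof ℂ I _ i ⟨weightFun n hn k (γ i) q, weightFun_mem hn (hγ i) h1 h2⟩, ?_⟩
    exact (translateSum_lof hn hγ hu i _).trans (leftActLin_weightFun hn (hu i) _ _ _)
  rintro ⟨_, p, ⟨hp, hl⟩, rfl⟩
  obtain ⟨x, hx⟩ := hU3 (homogeneous_harmonic_le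
    (fun q hq => harmBideg_le_of_primitives_le hU1 hU2 hq) hp hl)
  exact ⟨x, Subtype.ext hx⟩

theorem translateSum_comp_directSum (q : Sp1) :
    translateSum hn k γ hγ u hu ∘ₗ
        Representation.directSum (fun i => (spW n hn k (γ i)).toRepresentation) q =
      (harm n k).toRepresentation q ∘ₗ translateSum hn k γ hγ u hu := by
  refine DirectSum.linearMap_ext ℂ fun i => LinearMap.ext fun w => Subtype.ext ?_
  simp only [LinearMap.comp_apply, Representation.directSum_apply, DirectSum.lmap_lof]
  rw [translateSum_lof]
  refine (leftAct_rightRep (hu i) q w).trans ?_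
  exact congrArg (rightRep n q) (translateSum_lof hn hγ hu i w).symm

theorem nonempty_equiv_of_bijective
    (h : Function.Bijective (translateSum hn k γ hγ u hu)) :
    Nonempty ((harm n k).toRepresentation.Equiv
      (Representation.directSum fun i => (spW n hn k (γ i)).toRepresentation)) :=
  ⟨(Representation.Equiv.mk (LinearEquiv.ofBijective (translateSum hn k γ hγ u hu) h)
    fun q => translateSum_comp_directSum hn hγ hu q).symm⟩

end translateSum

/-- The harmonic functions of degree `k` are the direct sum of translates of the spaces `W`. -/
theorem nonempty_harm_equiv (hn : 2 ≤ n) (k : ℕ) : Nonempty ((harm n k).toRepresentation.Equiv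
    (Representation.directSum (fun i : Σ γ : Fin (k / 2 + 1), Fin (spDim n hn k γ) =>
      (spW n hn k i.1).toRepresentation))) := by
  have hγ : ∀ γ : Fin (k / 2 + 1), (γ : ℕ) ≤ k / 2 := fun γ => Nat.lt_succ_iff.1 γ.2
  choose u hu hli hspan using fun γ : Fin (k / 2 + 1) => exists_spGroup_basis hn (hγ γ)
  refine nonempty_equiv_of_bijective hn
    (I := Σ γ : Fin (k / 2 + 1), Fin (spDim n hn k γ)) (γ := fun i => (i.1 : ℕ))
    (fun i => hγ i.1) (u := fun i => u i.1 i.2) (fun i => hu i.1 i.2) ?_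
  refine ⟨translateSum_injective hn _ _ fun q g hg h => ?_,
    translateSum_surjective hn _ _ fun q hq => ?_⟩
  · funext ⟨γ, j⟩
    by_cases hq : (γ : ℕ) = q
    · refine Fintype.linearIndependent_iff.1 (hli γ) (fun j => g ⟨γ, j⟩) ?_ j
      rw [← h, Fintype.sum_sigma, Fintype.sum_eq_single γ]
      intro γ' hne
      refine Finset.sum_eq_zero fun j _ => ?_
      rw [hg ⟨γ', j⟩ (fun h' => hne (Fin.ext (h'.trans hq.symm))), zero_smul]
    · exact hg ⟨γ, j⟩ hq
  · rw [hspan ⟨q, Nat.lt_succ_of_le hq⟩]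
    refine Submodule.span_mono ?_
    rintro _ ⟨j, rfl⟩
    exact ⟨⟨⟨q, Nat.lt_succ_of_le hq⟩, j⟩, rfl⟩

end QuatHarm

theorem proposition2 (n : ℕ) (hn : 2 ≤ n) (k : ℕ) :
    (∀ γ : ℕ, γ ≤ k / 2 →
      QuatHarm.spW n hn k γ ≤ QuatHarm.harm n k ∧
      (QuatHarm.spW n hn k γ).toRepresentation.IsIrreducible ∧
      QuatHarm.HasHighestWeight (QuatHarm.spW n hn k γ) (k - 2 * γ) ∧
      (QuatHarm.spDim n hn k γ : ℚ) =
        (Nat.factorial (k - γ + 2 * n - 2) * Nat.factorial (γ + 2 * n - 3) *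
            (k - 2 * γ + 1) * (k + 2 * n - 1) : ℚ) /
          (Nat.factorial (k - γ + 1) * Nat.factorial γ * Nat.factorial (2 * n - 1) *
            Nat.factorial (2 * n - 3))) ∧
    (∀ γ γ' : ℕ, γ ≤ k / 2 → γ' ≤ k / 2 → γ ≠ γ' →
      IsEmpty ((QuatHarm.spW n hn k γ).toRepresentation.Equiv
        (QuatHarm.spW n hn k γ').toRepresentation)) ∧
    Nonempty ((QuatHarm.harm n k).toRepresentation.Equiv
      (Representation.directSum
        (fun i : Σ γ : Fin (k / 2 + 1), Fin (QuatHarm.spDim n hn k γ) =>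
          (QuatHarm.spW n hn k i.1).toRepresentation))) := by
  refine ⟨fun γ hγ => ⟨QuatHarm.spWSubmodule_le_harmSubmodule hn hγ,
    QuatHarm.spW_isIrreducible hn hγ, QuatHarm.spW_hasHighestWeight hn hγ,
    QuatHarm.spDim_formula hn hγ⟩, fun γ γ' hγ hγ' h => QuatHarm.isEmpty_equiv hn hγ hγ' h,
    QuatHarm.nonempty_harm_equiv hn k⟩
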